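/- A dyadic subdivision of $[0,1]$ is a subdivision obtained by repeatedly cutting intervals in half, starting from $[0,1]$. Let $F$ be Thompson's group: the group of all homeomorphisms $f$ of $[0,1]$ for which there are dyadic subdivisions $\mathcal D,\mathcal R$ of $[0,1]$ with the same number of intervals such that $f$ maps the $i$-th interval of $\mathcal D$ linearly (preserving the orientation) onto the $i$-th interval of $\mathcal R$, for every $i$. Products are read from left to right: $(fg)(t)=g(f(t))$. Let $x_0\in F$ be the element that maps $[0,\frac14],[\frac14,\frac12],[\frac12,1]$ linearly onto $[0,\frac12],[\frac12,\frac34],[\frac34,1]$, and $x_1\in F$ the element that maps $[0,\frac12],[\frac12,\frac58],[\frac58,\frac34],[\frac34,1]$ linearly onto $[0,\frac12],[\frac12,\frac34],[\frac34,\frac78],[\frac78,1]$. Let $\ell(f)$ be the length of $f\in F$ with respect to the generating set $\{x_0,x_1\}$, that is, the least length of a word in $x_0,x_1,x_0^{-1},x_1^{-1}$ that represents $f$. A dead end is an element $f\in F$ such that $\ell(xf)<\ell(f)$ for all $x\in\{x_0,x_1,x_0^{-1},x_1^{-1}\}$. For $k\in\mathbb N$, a $k$-pocket of $F$ is an element $f\in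 F$ such that $\ell(s_1\cdots s_kf)\le\ell(f)$ for all $s_1,\dots,s_k\in\{x_0,x_1,x_0^{-1},x_1^{-1},1\}$. Proposition. $F$ has no $k$-pockets for $k\ge 3$. More precisely, for every dead end $f\in F$, the element $x_1^{-1}x_1^{-1}x_0f$ has length $\ell(f)+1$. -/

import Mathlib

open unitInterval

namespace Thompson

/-! ### Dyadic subdivisions and dyadic rearrangements -/

/-- The intervals `(a, b)`, listed from left to right, of the subdivision of `[a, b]` obtained
by repeatedly cutting intervals in half as prescribed by a finite binary tree: `nil` leaves
the interval whole, `node` cuts it in half and goes on in the two halves. -/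
noncomputable def leaves : BinaryTree Unit → ℝ → ℝ → List (ℝ × ℝ)
  | .nil, a, b => [(a, b)]
  | .node _ l r, a, b => leaves l a ((a + b) / 2) ++ leaves r ((a + b) / 2) b

/-- `f` maps the interval `J = [J.1, J.2]` linearly (and preserving the orientation) onto the
interval `K = [K.1, K.2]`. -/
def MapsLinearly (f : I ≃ₜ I) (J K : ℝ × ℝ) : Prop :=
  ∀ s : ℝ, 0 ≤ s → s ≤ 1 → ∀ x : I, (x : ℝ) = (1 - s) * J.1 + s * J.2 →
    (f x : ℝ) = (1 - s) * K.1 + s * K.2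

/-- `f` maps the `i`-th interval of the dyadic subdivision `D` of `[0, 1]` linearly onto the
`i`-th interval of the dyadic subdivision `R` of `[0, 1]`, for every `i`; in particular the two
subdivisions have the same number of intervals. -/
def HasTreeDiagram (f : I ≃ₜ I) (D R : BinaryTree Unit) : Prop :=
  List.Forall₂ (MapsLinearly f) (leaves D 0 1) (leaves R 0 1)

/-- Dyadic rearrangements of `[0, 1]`. -/
def IsDyadicRearrangement (f : I ≃ₜ I) : Prop :=
  ∃ D R : BinaryTree Unit, HasTreeDiagram f D R

/-! ### Dyadic rearrangements form a group -/

theorem length_leaves (T : BinaryTree Unit) (a b : ℝ) :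
    (leaves T a b).length = T.numLeaves := by
  induction T generalizing a b with
  | nil => rfl
  | node v l r ihl ihr => simp [leaves, ihl, ihr]

theorem leaves_mem_Icc (T : BinaryTree Unit) (a b : ℝ) (h : a ≤ b) (J : ℝ × ℝ)
    (hJ : J ∈ leaves T a b) : a ≤ J.1 ∧ J.1 ≤ J.2 ∧ J.2 ≤ b := by
  induction T generalizing a b with
  | nil =>
    simp only [leaves, List.mem_singleton] at hJ
    subst hJ
    exact ⟨le_rfl, h, le_rfl⟩
  | node v l r ihl ihr =>
    simp only [leaves, List.mem_append] at hJ
    rcases hJ with hJ | hJ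
    · have := ihl a _ (by linarith) hJ
      exact ⟨this.1, this.2.1, by linarith⟩
    · have := ihr _ b (by linarith) hJ
      exact ⟨by linarith, this.2.1, this.2.2⟩

/-- Cutting each interval of a list further, each according to its own tree. -/
noncomputable def cutAll (L : List (ℝ × ℝ)) (Vs : List (BinaryTree Unit)) : List (ℝ × ℝ) :=
  (List.zipWith (fun J V => leaves V J.1 J.2) L Vs).flatten

theorem cutAll_append (L L' : List (ℝ × ℝ)) (Vs Vs' : List (BinaryTree Unit))
    (h : L.length = Vs.length) :
    cutAll (L ++ L') (Vs ++ Vs') = cutAll L Vs ++ cutAll L' Vs' := by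
  simp [cutAll, List.zipWith_append h]

theorem cutAll_replicate_nil (L : List (ℝ × ℝ)) :
    cutAll L (List.replicate L.length .nil) = L := by
  induction L with
  | nil => rfl
  | cons J L ih =>
    simp only [cutAll, List.length_cons, List.replicate_succ, List.zipWith_cons_cons, leaves,
      List.flatten_cons, List.singleton_append] at ih ⊢
    rw [ih]

theorem exists_graft (T : BinaryTree Unit) (Vs : List (BinaryTree Unit))
    (h : Vs.length = T.numLeaves) :
    ∃ T' : BinaryTree Unit, ∀ a b, leaves T' a b = cutAll (leaves T a b) Vs := by
  induction T generalizing Vs with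
  | nil =>
    obtain ⟨V, rfl⟩ := List.length_eq_one_iff.1 h
    exact ⟨V, fun a b => by simp [cutAll, leaves]⟩
  | node v l r ihl ihr =>
    simp only [BinaryTree.numLeaves] at h
    obtain ⟨l', hl⟩ := ihl (Vs.take l.numLeaves) (by simp; omega)
    obtain ⟨r', hr⟩ := ihr (Vs.drop l.numLeaves) (by simp; omega)
    refine ⟨.node v l' r', fun a b => ?_⟩
    conv_rhs => rw [← List.take_append_drop l.numLeaves Vs]
    simp only [leaves]
    rw [cutAll_append _ _ _ _ (by simp [length_leaves]; omega), hl, hr]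

theorem exists_common_refinement (T U : BinaryTree Unit) :
    ∃ Vs Ws : List (BinaryTree Unit), Vs.length = T.numLeaves ∧ Ws.length = U.numLeaves ∧
      ∀ a b, cutAll (leaves T a b) Vs = cutAll (leaves U a b) Ws := by
  induction T generalizing U with
  | nil =>
    refine ⟨[U], List.replicate U.numLeaves .nil, rfl, by simp, fun a b => ?_⟩
    rw [← length_leaves U a b, cutAll_replicate_nil]
    simp [cutAll, leaves]
  | node v l r ihl ihr =>
    cases U with
    | nil =>
      refine ⟨List.replicate (BinaryTree.node v l r).numLeaves .nil, [.node v l r], by simp, rfl,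
        fun a b => ?_⟩
      rw [← length_leaves _ a b, cutAll_replicate_nil]
      simp [cutAll, leaves]
    | node v' l' r' =>
      obtain ⟨V1, W1, hV1, hW1, h1⟩ := ihl l'
      obtain ⟨V2, W2, hV2, hW2, h2⟩ := ihr r'
      refine ⟨V1 ++ V2, W1 ++ W2, by simp [hV1, hV2], by simp [hW1, hW2], fun a b => ?_⟩
      simp only [leaves]
      rw [cutAll_append _ _ _ _ (by simp [length_leaves, hV1]),
        cutAll_append _ _ _ _ (by simp [length_leaves, hW1]), h1, h2]

theorem MapsLinearly.leaves {f : I ≃ₜ I} (V : BinaryTree Unit) {a b c d : ℝ}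
    (h : MapsLinearly f (a, b) (c, d)) :
    List.Forall₂ (MapsLinearly f) (leaves V a b) (leaves V c d) := by
  induction V generalizing a b c d with
  | nil => exact .cons h .nil
  | node v l r ihl ihr =>
    refine List.rel_append (ihl ?_) (ihr ?_)
    · intro s h0 h1 x hx
      rw [h (s / 2) (by linarith) (by linarith) x (by rw [hx]; ring)]
      ring
    · intro s h0 h1 x hx
      rw [h ((1 + s) / 2) (by linarith) (by linarith) x (by rw [hx]; ring)]
      ring

theorem forall₂_cutAll {f : I ≃ₜ I} {L L' : List (ℝ × ℝ)}
    (h : List.Forall₂ (MapsLinearly f) L L') (Vs : List (BinaryTree Unit)) :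
    List.Forall₂ (MapsLinearly f) (cutAll L Vs) (cutAll L' Vs) := by
  induction h generalizing Vs with
  | nil => exact .nil
  | cons hJ _ ih =>
    cases Vs with
    | nil => exact .nil
    | cons V Vs => exact List.rel_append (MapsLinearly.leaves V hJ) (ih Vs)

theorem isDyadicRearrangement_refl : IsDyadicRearrangement (Homeomorph.refl I) :=
  ⟨.nil, .nil, .cons (fun _ _ _ _ hx => hx) .nil⟩

theorem IsDyadicRearrangement.symm {f : I ≃ₜ I} (hf : IsDyadicRearrangement f) :
    IsDyadicRearrangement f.symm := by
  obtain ⟨D, R, h⟩ := hf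
  refine ⟨R, D, ?_⟩
  have h' : List.Forall₂ (fun J K => MapsLinearly f J K ∧ J ∈ leaves D 0 1)
      (leaves D 0 1) (leaves R 0 1) := by
    unfold HasTreeDiagram at h
    rw [List.forall₂_iff_get] at h ⊢
    exact ⟨h.1, fun i h1 h2 => ⟨h.2 i h1 h2, List.get_mem _ _⟩⟩
  refine List.Forall₂.flip (h'.imp ?_)
  rintro J K ⟨hJK, hJ⟩ s h0 h1 y hy
  obtain ⟨h2, h3, h4⟩ := leaves_mem_Icc D 0 1 zero_le_one J hJ
  have hx : (1 - s) * J.1 + s * J.2 ∈ I := ⟨by nlinarith, by nlinarith⟩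
  have := hJK s h0 h1 ⟨_, hx⟩ rfl
  have hfy : f ⟨_, hx⟩ = y := Subtype.ext (by rw [this, hy])
  rw [← hfy, Homeomorph.symm_apply_apply]

theorem IsDyadicRearrangement.trans {f g : I ≃ₜ I} (hf : IsDyadicRearrangement f)
    (hg : IsDyadicRearrangement g) : IsDyadicRearrangement (f.trans g) := by
  obtain ⟨T, U, h1⟩ := hf
  obtain ⟨V, W, h2⟩ := hg
  obtain ⟨As, Bs, hA, hB, hAB⟩ := exists_common_refinement U V
  have hTU : T.numLeaves = U.numLeaves := by
    rw [← length_leaves T 0 1, ← length_leaves U 0 1]; exact h1.length_eq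
  have hVW : V.numLeaves = W.numLeaves := by
    rw [← length_leaves V 0 1, ← length_leaves W 0 1]; exact h2.length_eq
  obtain ⟨T', hT'⟩ := exists_graft T As (by omega)
  obtain ⟨W', hW'⟩ := exists_graft W Bs (by omega)
  refine ⟨T', W', ?_⟩
  have k1 := forall₂_cutAll h1 As
  have k2 := forall₂_cutAll h2 Bs
  rw [hAB] at k1
  unfold HasTreeDiagram
  rw [hT', hW']
  generalize cutAll (leaves T 0 1) As = L1 at k1 ⊢
  generalize cutAll (leaves V 0 1) Bs = L2 at k1 k2
  generalize cutAll (leaves W 0 1) Bs = L3 at k2 ⊢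
  induction k1 generalizing L3 with
  | nil => cases k2; exact .nil
  | cons hJ _ ih =>
    cases k2 with
    | cons hK k2 =>
      refine .cons ?_ (ih _ k2)
      intro s h0 h1 x hx
      exact hK s h0 h1 _ (hJ s h0 h1 x hx)

/-- Thompson's group `F`: all dyadic rearrangements of `[0, 1]`, with products read from left
to right, so that `f * g` is "`f` followed by `g`"; this is why the group of homeomorphisms is
replaced with its opposite (see `mul_apply` below). -/
def F : Subgroup (I ≃ₜ I)ᵐᵒᵖ where
  carrier := {f | IsDyadicRearrangement f.unop}
  mul_mem' := fun hf hg => IsDyadicRearrangement.trans hf hg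
  one_mem' := isDyadicRearrangement_refl
  inv_mem' := fun hf => IsDyadicRearrangement.symm hf

/-- The homeomorphism of `[0, 1]` underlying an element of `F`. -/
def toHomeo (f : F) : I ≃ₜ I := (f : (I ≃ₜ I)ᵐᵒᵖ).unop

theorem mul_apply (f g : F) (t : I) : toHomeo (f * g) t = toHomeo g (toHomeo f t) := rfl

/-! ### The generators -/

/-- The piecewise linear homeomorphism of `[0, 1]` that maps `[0, 1/4]`, `[1/4, 1/2]`,
`[1/2, 1]` linearly onto `[0, 1/2]`, `[1/2, 3/4]`, `[3/4, 1]`. -/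
noncomputable def x0Homeo : I ≃ₜ I where
  toFun t := ⟨min (2 * (t : ℝ)) (min (t + 1 / 4) ((t + 1) / 2)), by
    have h0 := t.2.1; have h1 := t.2.2
    refine ⟨?_, ?_⟩
    · exact le_min (by linarith) (le_min (by linarith) (by linarith))
    · exact (min_le_right _ _).trans ((min_le_right _ _).trans (by linarith))⟩
  invFun t := ⟨max ((t : ℝ) / 2) (max (t - 1 / 4) (2 * t - 1)), by
    have h0 := t.2.1; have h1 := t.2.2
    refine ⟨?_, ?_⟩
    · exact le_max_of_le_left (by linarith)
    · exact max_le (by linarith) (max_le (by linarith) (by linarith))⟩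
  left_inv t := by
    ext; simp only
    grind
  right_inv t := by
    ext; simp only
    grind
  continuous_toFun := by fun_prop
  continuous_invFun := by fun_prop

theorem coe_x0Homeo (t : I) :
    (x0Homeo t : ℝ) = min (2 * (t : ℝ)) (min (t + 1 / 4) ((t + 1) / 2)) := rfl

/-- The piecewise linear homeomorphism of `[0, 1]` that maps `[0, 1/2]`, `[1/2, 5/8]`,
`[5/8, 3/4]`, `[3/4, 1]` linearly onto `[0, 1/2]`, `[1/2, 3/4]`, `[3/4, 7/8]`, `[7/8, 1]`. -/
noncomputable def x1Homeo : I ≃ₜ I where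
  toFun t := ⟨max (t : ℝ) (min (2 * t - 1 / 2) (min (t + 1 / 8) ((t + 1) / 2))), by
    have h0 := t.2.1; have h1 := t.2.2
    refine ⟨?_, ?_⟩
    · exact le_max_of_le_left (by linarith)
    · exact max_le h1 ((min_le_right _ _).trans ((min_le_right _ _).trans (by linarith)))⟩
  invFun t := ⟨min (t : ℝ) (max (t / 2 + 1 / 4) (max (t - 1 / 8) (2 * t - 1))), by
    have h0 := t.2.1; have h1 := t.2.2
    refine ⟨?_, ?_⟩
    · exact le_min h0 (le_max_of_le_left (by linarith))
    · exact (min_le_left _ _).trans h1⟩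
  left_inv t := by
    have h0 := t.2.1; have h1 := t.2.2
    ext; simp only
    grind
  right_inv t := by
    have h0 := t.2.1; have h1 := t.2.2
    ext; simp only
    grind
  continuous_toFun := by fun_prop
  continuous_invFun := by fun_prop

theorem coe_x1Homeo (t : I) :
    (x1Homeo t : ℝ) = max (t : ℝ) (min (2 * t - 1 / 2) (min (t + 1 / 8) ((t + 1) / 2))) := rfl

/-- A caret with the two given subtrees. -/
abbrev caret (l r : BinaryTree Unit) : BinaryTree Unit := .node () l r

/-- `x₀` has the tree diagram `(ab)c → a(bc)`. -/
theorem x0Homeo_hasTreeDiagram :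
    HasTreeDiagram x0Homeo (caret (caret .nil .nil) .nil) (caret .nil (caret .nil .nil)) := by
  simp only [HasTreeDiagram, leaves, List.cons_append, List.nil_append, List.forall₂_cons,
    MapsLinearly, coe_x0Homeo]
  refine ⟨?_, ?_, ?_, .nil⟩
  all_goals
    intro s h0 h1 x hx
    rw [hx]
    grind

/-- `x₁` has the tree diagram `a((bc)d) → a(b(cd))`. -/
theorem x1Homeo_hasTreeDiagram :
    HasTreeDiagram x1Homeo (caret .nil (caret (caret .nil .nil) .nil))
      (caret .nil (caret .nil (caret .nil .nil))) := by
  simp only [HasTreeDiagram, leaves, List.cons_append, List.nil_append, List.forall₂_cons,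
    MapsLinearly, coe_x1Homeo]
  refine ⟨?_, ?_, ?_, ?_, .nil⟩
  all_goals
    intro s h0 h1 x hx
    rw [hx]
    grind

/-- The generator `x₀` of `F`. -/
noncomputable def x0 : F := ⟨.op x0Homeo, _, _, x0Homeo_hasTreeDiagram⟩

/-- The generator `x₁` of `F`. -/
noncomputable def x1 : F := ⟨.op x1Homeo, _, _, x1Homeo_hasTreeDiagram⟩

/-! ### Lengths, dead ends and pockets -/

/-- `IsWordFor f w`: the word `w` in the letters `x₀, x₁, x₀⁻¹, x₁⁻¹` represents `f`. -/
def IsWordFor (f : F) (w : List F) : Prop :=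
  (∀ s ∈ w, s ∈ ({x0, x1, x0⁻¹, x1⁻¹} : Set F)) ∧ w.prod = f

/-- The length of `f` with respect to the generating set `{x₀, x₁}`: the least length of a word
in the letters `x₀, x₁, x₀⁻¹, x₁⁻¹` that represents `f`. -/
noncomputable def length (f : F) : ℕ :=
  sInf {n : ℕ | ∃ w : List F, IsWordFor f w ∧ w.length = n}

/-- A dead end: every generator shortens `f` by multiplication on the left. -/
def IsDeadEnd (f : F) : Prop :=
  ∀ x ∈ ({x0, x1, x0⁻¹, x1⁻¹} : Set F), length (x * f) < length f

/-- A `k`-pocket: no product of `k` factors from `{x₀, x₁, x₀⁻¹, x₁⁻¹, 1}` makes `f` longer by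
multiplication on the left. -/
def IsPocket (k : ℕ) (f : F) : Prop :=
  ∀ s : Fin k → F, (∀ i, s i ∈ ({x0, x1, x0⁻¹, x1⁻¹, 1} : Set F)) →
    length ((List.ofFn s).prod * f) ≤ length f

end Thompson

namespace Thompson

/-! ### Labels of the spaces between the leaves of a tree -/

/-! The proof rests on a length formula in the style of Fordham and of Belk and Brown. In a source
tree `caret l (caret a b)` the carets on the two outer spines are scaffolding. What hangs from them
is a row of binary trees, and a pointer marks the current tree `a`, over `[1/2, 3/4]`. Left
multiplication by `x0` moves the pointer one tree to the right, and `x1` joins the current tree to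
the next one by a caret. The inverses move the pointer left and remove the top caret of the current
tree. Each move changes the label of a single space between leaves, apart from expansions needed to
make it possible and cancellations afterwards.

Opposite spaces of the two trees are weighted by their pair of labels, and `cost` adds the weights.
The minimal cost over the diagrams of `f` with a nontrivial source tree is `length f + 2`, where 2
is the cost of the one-caret diagram of the identity. One inequality holds because a generator
raises the cost by at most 1 (`exists_gen_mul`). The other holds because reductions never raise it
(`cost_le_cost_expand`) and some generator lowers it for every reduced diagram other than the
one-caret one (`hasDescent`). Hence `exists_minimal_diagram`: a reduced diagram realizes the length.

Now let `f` be a dead end. If `f` did not map `[3/4, 7/8]` linearly onto a standard dyadic interval,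
then `x1` would lengthen `f` (`length_lt_x1_mul`). So it does, and `x0 * f` maps `[1/2, 3/4]`
linearly onto a standard interval. Whenever an element does this, `x1⁻¹` lengthens it
(`length_lt_x1_inv_mul`), and the product has the same property, because `x1⁻¹` maps `[1/2, 3/4]`
onto its left half. The three letters therefore change the length by -1, +1 and +1.

A `k`-pocket with `k ≥ 1` is a dead end, since a generator always changes the length: the exponent
of the slope at 1 determines its parity (`length_gen_mul_ne`). -/

/-- The labels of the spaces between consecutive leaves: exterior to the left of the pointer
(`lft`), exterior to the right of the pointer (`nex` if the next tree is nontrivial, `rgt` if it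
is trivial, `fin` if the space is the last one), and interior (`nin` if the next leaf is a left
child, `inn` if it is a right child). -/
inductive Label
  | lft | nex | nin | rgt | fin | inn

open Label

/-- The contribution of a space to the length, given its labels in the two trees. -/
def weight : Label → Label → ℕ
  | lft, lft => 2
  | lft, nin => 2
  | lft, inn => 2
  | lft, _ => 1
  | nin, lft => 2
  | inn, lft => 2
  | _, lft => 1
  | fin, fin => 0
  | rgt, inn => 1
  | fin, inn => 1
  | inn, rgt => 1
  | inn, fin => 1
  | inn, inn => 2
  | nin, nin => 4
  | nin, inn => 4
  | inn, nin => 4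
  | nin, _ => 3
  | _, nin => 3
  | inn, nex => 3
  | nex, inn => 3
  | nex, _ => 2
  | rgt, _ => 2
  | fin, _ => 2

/-- The label of an interior space in front of a right subtree. -/
def innerLabel : BinaryTree Unit → Label
  | .nil => inn
  | .node _ _ _ => nin

/-- The label of the space on the right spine in front of a right subtree. -/
def spineLabel : BinaryTree Unit → Label
  | .nil => fin
  | .node _ .nil _ => rgt
  | .node _ (.node _ _ _) _ => nex

/-- Labels of a tree that lies in the interior. -/
def innerLabels : BinaryTree Unit → List Label
  | .nil => []
  | .node _ a b => innerLabels a ++ innerLabel b :: innerLabels b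

/-- Labels of the left half of the whole tree. -/
def leftLabels : BinaryTree Unit → List Label
  | .nil => []
  | .node _ a b => leftLabels a ++ lft :: innerLabels b

/-- Labels of the right half of the whole tree. -/
def rightLabels : BinaryTree Unit → List Label
  | .nil => []
  | .node _ a b => innerLabels a ++ spineLabel b :: rightLabels b

/-- Labels of the whole tree. -/
def labels : BinaryTree Unit → List Label
  | .nil => []
  | .node _ l r => leftLabels l ++ lft :: rightLabels r

theorem length_innerLabels (T : BinaryTree Unit) : (innerLabels T).length + 1 = T.numLeaves := by
  induction T with
  | nil => rfl
  | node v a b iha ihb => simp [innerLabels, BinaryTree.numLeaves]; omega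

theorem length_leftLabels (T : BinaryTree Unit) : (leftLabels T).length + 1 = T.numLeaves := by
  induction T with
  | nil => rfl
  | node v a b iha ihb =>
    have := length_innerLabels b
    simp [leftLabels, BinaryTree.numLeaves]; omega

theorem length_rightLabels (T : BinaryTree Unit) : (rightLabels T).length + 1 = T.numLeaves := by
  induction T with
  | nil => rfl
  | node v a b iha ihb =>
    have := length_innerLabels a
    simp [rightLabels, BinaryTree.numLeaves]; omega

theorem length_labels (T : BinaryTree Unit) : (labels T).length + 1 = T.numLeaves := by
  cases T with
  | nil => rfl
  | node v a b =>
    have := length_leftLabels a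
    have := length_rightLabels b
    simp [labels, BinaryTree.numLeaves]; omega

/-! ### Total weights -/

/-- The total weight of two lists of labels. -/
def total (A B : List Label) : ℕ := (List.zipWith weight A B).sum

theorem total_append {A B A' B' : List Label} (h : A.length = B.length) :
    total (A ++ A') (B ++ B') = total A B + total A' B' := by
  simp [total, List.zipWith_append h]

@[simp] theorem total_cons (x y : Label) (A B : List Label) :
    total (x :: A) (y :: B) = weight x y + total A B := by
  simp [total]

@[simp] theorem total_nil : total [] [] = 0 := rfl

/-- The total weight of a tree diagram; it exceeds the length of the element by 2. -/
def cost (D R : BinaryTree Unit) : ℕ := total (labels D) (labels R)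

theorem exists_split {n m : ℕ} {B : List Label} (h : B.length = n + (m + 1)) :
    ∃ U y V, B = U ++ y :: V ∧ U.length = n ∧ V.length = m := by
  refine ⟨B.take n, B[n], B.drop (n + 1), ?_, by simp; omega, by simp; omega⟩
  simp

/-! ### Expanding a leaf -/

/-- Attach a caret to the `i`-th leaf. -/
def expand : ℕ → BinaryTree Unit → BinaryTree Unit
  | _, .nil => caret .nil .nil
  | i, .node _ a b =>
    if i < a.numLeaves then caret (expand i a) b else caret a (expand (i - a.numLeaves) b)

theorem expand_left {i : ℕ} {a : BinaryTree Unit} (b : BinaryTree Unit) (h : i < a.numLeaves) :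
    expand i (caret a b) = caret (expand i a) b := by simp [expand, h]

theorem expand_right (i : ℕ) (a b : BinaryTree Unit) :
    expand (a.numLeaves + i) (caret a b) = caret a (expand i b) := by simp [expand]

theorem expand_ne_nil (i : ℕ) (T : BinaryTree Unit) : expand i T ≠ .nil := by
  cases T with
  | nil => simp [expand]
  | node v a b => rw [expand]; split <;> simp

theorem numLeaves_expand (i : ℕ) (T : BinaryTree Unit) :
    (expand i T).numLeaves = T.numLeaves + 1 := by
  induction T generalizing i with
  | nil => rfl
  | node v a b iha ihb =>
    rw [expand]
    split
    · simp [BinaryTree.numLeaves, iha]; omega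
    · simp [BinaryTree.numLeaves, ihb]; omega

/-- The label of a space after the next leaf has become a left child. -/
def toN : Label → Label
  | lft => lft
  | inn => nin
  | nin => nin
  | _ => nex

/-- The label of the last space after the last leaf has been expanded. -/
def toR : Label → Label
  | fin => rgt
  | x => x

/-- The effect of expanding the `i`-th leaf on a list of labels. -/
def ins : ℕ → List Label → List Label
  | 0, A => inn :: A
  -- A default value, never reached as long as the index is at most the length of the list.
  | _ + 1, [] => []
  | 1, x :: A => toN x :: inn :: A
  | i + 2, x :: A => x :: ins (i + 1) A

theorem ins_append_left {i : ℕ} {A : List Label} (B : List Label) (h : i ≤ A.length) :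
    ins i (A ++ B) = ins i A ++ B := by
  induction A generalizing i with
  | nil => obtain rfl : i = 0 := by simpa using h
           rfl
  | cons x A ih =>
    match i, h with
    | 0, _ => rfl
    | 1, _ => rfl
    | i + 2, h =>
      simp only [List.length_cons] at h
      simp [ins, ih (show i + 1 ≤ A.length by omega)]

theorem ins_append_cons (A B : List Label) (x : Label) :
    ins (A.length + 1) (A ++ x :: B) = A ++ toN x :: inn :: B := by
  induction A with
  | nil => rfl
  | cons y A ih => simpa [ins] using ih

theorem ins_append_right (i : ℕ) (A B : List Label) (x : Label) :
    ins (A.length + 1 + (i + 1)) (A ++ x :: B) = A ++ x :: ins (i + 1) B := by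
  induction A with
  | nil =>
    rw [show [].length + 1 + (i + 1) = i + 2 by simp; omega]
    rfl
  | cons y A ih =>
    rw [show (y :: A).length + 1 + (i + 1) = A.length + 1 + i + 2 by simp; omega]
    simp only [List.cons_append, ins]
    rw [← ih, show A.length + 1 + (i + 1) = A.length + 1 + i + 1 by omega]

theorem innerLabel_expand (i : ℕ) (T : BinaryTree Unit) :
    innerLabel (expand i T) = nin := by
  have := expand_ne_nil i T
  revert this
  cases expand i T <;> simp [innerLabel]

theorem innerLabel_of_ne {T : BinaryTree Unit} (h : T ≠ .nil) : innerLabel T = nin := by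
  revert h
  cases T <;> simp [innerLabel]

theorem toN_innerLabel (T : BinaryTree Unit) : toN (innerLabel T) = nin := by
  cases T <;> rfl

theorem innerLabels_expand {i : ℕ} {T : BinaryTree Unit} (h : i < T.numLeaves) :
    innerLabels (expand i T) = ins i (innerLabels T) := by
  induction T generalizing i with
  | nil =>
    obtain rfl : i = 0 := by simpa using h
    rfl
  | node v a b iha ihb =>
    have ha := length_innerLabels a
    by_cases hi : i < a.numLeaves
    · rw [expand_left b hi, innerLabels, iha hi, innerLabels, ins_append_left _ (by omega)]
    · obtain ⟨j, rfl⟩ := Nat.exists_eq_add_of_le (not_lt.1 hi)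
      simp only [BinaryTree.numLeaves] at h
      rw [expand_right, innerLabels, ihb (by omega), innerLabels, ← ha, innerLabel_expand]
      rcases j with _ | j
      · rw [Nat.add_zero, ins_append_cons, toN_innerLabel]
        rfl
      · rw [ins_append_right, innerLabel_of_ne]
        rintro rfl
        simp at h

/-- The first leaf ends the left spine, so the new space is exterior; this is why index 0 does not
follow `ins`. -/
theorem leftLabels_expand_zero (T : BinaryTree Unit) :
    leftLabels (expand 0 T) = lft :: leftLabels T := by
  induction T with
  | nil => rfl
  | node v a b iha ihb => rw [expand_left b a.numLeaves_pos, leftLabels, iha]; rfl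

theorem leftLabels_expand {i : ℕ} {T : BinaryTree Unit} (h0 : 0 < i) (h : i < T.numLeaves) :
    leftLabels (expand i T) = ins i (leftLabels T) := by
  induction T generalizing i with
  | nil => simp at h; omega
  | node v a b iha ihb =>
    have ha := length_leftLabels a
    by_cases hi : i < a.numLeaves
    · rw [expand_left b hi, leftLabels, iha h0 hi, leftLabels, ins_append_left _ (by omega)]
    · obtain ⟨j, rfl⟩ := Nat.exists_eq_add_of_le (not_lt.1 hi)
      simp only [BinaryTree.numLeaves] at h
      rw [expand_right, leftLabels, innerLabels_expand (by omega), leftLabels, ← ha]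
      rcases j with _ | j
      · rw [Nat.add_zero, ins_append_cons]; rfl
      · rw [ins_append_right]

theorem spineLabel_expand_zero {T : BinaryTree Unit} (h : T ≠ .nil) :
    spineLabel (expand 0 T) = toN (spineLabel T) := by
  cases T with
  | nil => exact absurd rfl h
  | node v a b =>
    rw [expand_left b a.numLeaves_pos]
    cases a with
    | nil => rfl
    | node w c d => rw [expand_left d c.numLeaves_pos]; rfl

theorem spineLabel_expand_succ {T : BinaryTree Unit} (j : ℕ) (h : T ≠ .nil) :
    spineLabel (expand (j + 1) T) = spineLabel T := by
  cases T with
  | nil => exact absurd rfl h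
  | node v a b =>
    cases a with
    | nil => simp [expand, spineLabel]
    | node w c d =>
      rw [expand]
      split
      · rw [expand]
        split <;> rfl
      · rfl

theorem rightLabels_expand {i : ℕ} {T : BinaryTree Unit} (h : i + 1 < T.numLeaves) :
    rightLabels (expand i T) = ins i (rightLabels T) := by
  induction T generalizing i with
  | nil => simp at h
  | node v a b iha ihb =>
    have ha := length_innerLabels a
    by_cases hi : i < a.numLeaves
    · rw [expand_left b hi, rightLabels, innerLabels_expand hi, rightLabels,
        ins_append_left _ (by omega)]
    · obtain ⟨j, rfl⟩ := Nat.exists_eq_add_of_le (not_lt.1 hi)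
      simp only [BinaryTree.numLeaves] at h
      have hb : b ≠ .nil := by
        rintro rfl
        simp at h
      rw [expand_right, rightLabels, ihb (by omega), rightLabels, ← ha]
      rcases j with _ | j
      · rw [Nat.add_zero, ins_append_cons, spineLabel_expand_zero hb]; rfl
      · rw [ins_append_right, spineLabel_expand_succ _ hb]

/-- The last leaf ends the right spine. After its expansion the old last space is followed by a
trivial tree, and the new space becomes the last one. -/
theorem rightLabels_expand_last {T : BinaryTree Unit} (h : T ≠ .nil) :
    ∃ U, rightLabels T = U ++ [fin] ∧
      rightLabels (expand (T.numLeaves - 1) T) = U ++ [rgt, fin] := by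
  induction T with
  | nil => exact absurd rfl h
  | node v a b iha ihb =>
    have ha := length_innerLabels a
    have hb := b.numLeaves_pos
    have e : (BinaryTree.node v a b).numLeaves - 1 = a.numLeaves + (b.numLeaves - 1) := by
      simp only [BinaryTree.numLeaves]; omega
    rw [e, expand_right]
    by_cases hb : b = .nil
    · subst hb
      exact ⟨innerLabels a, rfl, by simp [rightLabels, expand, spineLabel, innerLabels]⟩
    · obtain ⟨U, h1, h2⟩ := ihb hb
      refine ⟨innerLabels a ++ spineLabel b :: U, by simp [rightLabels, h1], ?_⟩
      rw [rightLabels, h2]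
      obtain ⟨j, hj⟩ : ∃ j, b.numLeaves - 1 = j + 1 := by
        cases b with
        | nil => exact absurd rfl hb
        | node w c d =>
          have := c.numLeaves_pos
          have := d.numLeaves_pos
          exact ⟨c.numLeaves + d.numLeaves - 2, by simp only [BinaryTree.numLeaves]; omega⟩
      rw [hj, spineLabel_expand_succ _ hb]
      simp

theorem labels_expand_zero {T : BinaryTree Unit} (h : T ≠ .nil) :
    labels (expand 0 T) = lft :: labels T := by
  cases T with
  | nil => exact absurd rfl h
  | node v l r =>
    rw [expand_left r l.numLeaves_pos, labels, leftLabels_expand_zero]; rfl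

theorem labels_expand {i : ℕ} {T : BinaryTree Unit} (h0 : 0 < i) (h : i + 1 < T.numLeaves) :
    labels (expand i T) = ins i (labels T) := by
  cases T with
  | nil => simp at h
  | node v l r =>
    have hl := length_leftLabels l
    by_cases hi : i < l.numLeaves
    · rw [expand_left r hi, labels, leftLabels_expand h0 hi, labels, ins_append_left _ (by omega)]
    · obtain ⟨j, rfl⟩ := Nat.exists_eq_add_of_le (not_lt.1 hi)
      simp only [BinaryTree.numLeaves] at h
      rw [expand_right, labels, rightLabels_expand (by omega), labels, ← hl]
      rcases j with _ | j
      · rw [Nat.add_zero, ins_append_cons]; rfl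
      · rw [ins_append_right]

theorem labels_expand_last {T : BinaryTree Unit} (h : T ≠ .nil) :
    ∃ U y, (y = lft ∨ y = fin) ∧ labels T = U ++ [y] ∧
      labels (expand (T.numLeaves - 1) T) = U ++ [toR y, fin] := by
  cases T with
  | nil => exact absurd rfl h
  | node v l r =>
    have hr := r.numLeaves_pos
    have e : (BinaryTree.node v l r).numLeaves - 1 = l.numLeaves + (r.numLeaves - 1) := by
      simp only [BinaryTree.numLeaves]; omega
    rw [e, expand_right]
    by_cases hb : r = .nil
    · subst hb
      exact ⟨leftLabels l, lft, .inl rfl, rfl, by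
        simp [labels, rightLabels, expand, spineLabel, innerLabels, toR]⟩
    · obtain ⟨U, h1, h2⟩ := rightLabels_expand_last hb
      exact ⟨leftLabels l ++ lft :: U, fin, .inr rfl, by simp [labels, h1], by
        simp [labels, h2, toR]⟩

/-! ### The cost of an expansion -/

theorem ne_nil_iff {T : BinaryTree Unit} : T ≠ .nil ↔ 2 ≤ T.numLeaves := by
  cases T with
  | nil => simp
  | node v a b =>
    have := a.numLeaves_pos
    have := b.numLeaves_pos
    simp [BinaryTree.numLeaves]; omega

/-- The loss of 2 is what the new pair of opposite spaces `inn`, `inn` makes up for. -/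
theorem weight_toN (x y : Label) : weight x y ≤ weight (toN x) (toN y) + 2 := by
  cases x <;> cases y <;> decide

/-- Away from the two ends, an expansion relabels the space before the leaf by `toN` and inserts
`inn` in both trees, so `weight_toN` applies. The first leaf adds a pair `lft`, `lft`; the last one
adds `fin`, `fin` of weight 0 and applies `toR` to the old last labels. -/
theorem cost_le_cost_expand {D R : BinaryTree Unit} (hD : D ≠ .nil)
    (h : D.numLeaves = R.numLeaves) {i : ℕ} (hi : i < D.numLeaves) :
    cost D R ≤ cost (expand i D) (expand i R) := by
  have hR : R ≠ .nil := by rw [ne_nil_iff, ← h, ← ne_nil_iff]; exact hD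
  have lD := length_labels D
  have lR := length_labels R
  unfold cost
  rcases Nat.eq_zero_or_pos i with rfl | h0
  · rw [labels_expand_zero hD, labels_expand_zero hR]
    simp
  · rcases Nat.lt_or_ge (i + 1) D.numLeaves with h1 | h1
    · rw [labels_expand h0 h1, labels_expand h0 (h ▸ h1)]
      obtain ⟨U, x, V, hU, hUl, hVl⟩ :=
        exists_split (B := labels D) (n := i - 1) (m := D.numLeaves - 1 - i) (by omega)
      obtain ⟨U', y, V', hU', hUl', hVl'⟩ :=
        exists_split (B := labels R) (n := i - 1) (m := D.numLeaves - 1 - i) (by omega)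
      have e : i = U.length + 1 := by omega
      have e' : i = U'.length + 1 := by omega
      rw [hU, hU']
      conv_rhs => rw [e, ins_append_cons, ← e, e', ins_append_cons]
      rw [total_append (by omega), total_append (by omega)]
      have := weight_toN x y
      simp only [total_cons]
      have : weight inn inn = 2 := rfl
      omega
    · obtain rfl : i = D.numLeaves - 1 := by omega
      obtain ⟨U, x, hx, h2, h3⟩ := labels_expand_last hD
      obtain ⟨U', y, hy, h2', h3'⟩ := labels_expand_last hR
      rw [h3, h, h3', h2, h2']
      have l1 := congrArg List.length h2
      have l2 := congrArg List.length h2'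
      simp only [List.length_append, List.length_cons, List.length_nil] at l1 l2
      rw [total_append (by omega), total_append (by omega)]
      have : weight x y ≤ weight (toR x) (toR y) := by
        rcases hx with rfl | rfl <;> rcases hy with rfl | rfl <;> decide
      simp only [total_cons]
      omega

/-- Expanding only the target tree, below a trivial current tree. -/
theorem cost_insert {l c R : BinaryTree Unit}
    (h : (caret l (caret .nil c)).numLeaves = R.numLeaves) :
    cost (caret l (caret .nil (caret .nil c))) (expand l.numLeaves R) =
      cost (caret l (caret .nil c)) R + 1 := by
  have lR := length_labels R
  have ll := length_leftLabels l
  have lr := length_rightLabels c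
  have := c.numLeaves_pos
  have := l.numLeaves_pos
  simp only [BinaryTree.numLeaves] at h
  unfold cost
  rw [labels_expand (by omega) (by omega)]
  obtain ⟨U, y, V, hU, hUl, hVl⟩ :=
    exists_split (B := labels R) (n := l.numLeaves - 1) (m := c.numLeaves) (by omega)
  obtain ⟨z, V, rfl⟩ : ∃ z W, V = z :: W := by
    cases V with
    | nil => simp at hVl; omega
    | cons z W => exact ⟨_, _, rfl⟩
  rw [hU, show l.numLeaves = U.length + 1 by omega, ins_append_cons]
  simp only [labels, rightLabels, innerLabels, List.nil_append, spineLabel]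
  rw [total_append (by omega), total_append (by omega)]
  simp only [total_cons]
  -- Opposite `lft` the relabelling is free, so the new pair `rgt`, `inn` is the whole difference.
  -- The difference is exactly 1, which is needed both for raising and for lowering the cost.
  have h1 : weight lft (toN y) = weight lft y := by cases y <;> rfl
  have h2 : weight rgt inn = 1 := rfl
  omega

/-! ### Adjacent labels -/

/-- The constraints on two adjacent labels. -/
def Adj (y z : Label) : Prop :=
  (z = lft → y = lft ∨ y = inn) ∧ (y = rgt → z = nex ∨ z = rgt ∨ z = fin) ∧ y ≠ fin

theorem innerLabels_last {T : BinaryTree Unit} (h : T ≠ .nil) :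
    ∃ U, innerLabels T = U ++ [inn] := by
  induction T with
  | nil => exact absurd rfl h
  | node v a b iha ihb =>
    by_cases hb : b = .nil
    · subst hb; exact ⟨innerLabels a, rfl⟩
    · obtain ⟨U, hU⟩ := ihb hb
      exact ⟨innerLabels a ++ innerLabel b :: U, by simp [innerLabels, hU]⟩

theorem innerLabels_mem (T : BinaryTree Unit) :
    ∀ x ∈ innerLabels T, x = inn ∨ x = nin := by
  induction T with
  | nil => simp [innerLabels]
  | node v a b iha ihb =>
    have : innerLabel b = inn ∨ innerLabel b = nin := by cases b <;> simp [innerLabel]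
    intro x hx
    simp only [innerLabels, List.mem_append, List.mem_cons] at hx
    grind

/-- Passes the chain through a whole tree of the row. The labels `rgt` and `fin` exclude a
nontrivial tree behind them, hence `h1`. -/
theorem isChain_cons_innerLabels (T : BinaryTree Unit) {z y : Label} {W : List Label}
    (h0 : T = .nil → Adj z y) (h1 : T ≠ .nil → z ≠ rgt ∧ z ≠ fin) (hW : (y :: W).IsChain Adj) :
    (z :: (innerLabels T ++ y :: W)).IsChain Adj := by
  induction T generalizing z y W with
  | nil => exact .cons_cons (h0 rfl) hW
  | node v a b iha ihb =>
    obtain ⟨hz1, hz2⟩ := h1 (by simp)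
    have e : innerLabels (.node v a b) ++ y :: W =
      innerLabels a ++ innerLabel b :: (innerLabels b ++ y :: W) := by simp [innerLabels]
    rw [e]
    refine iha (fun _ => ?_) (fun _ => ⟨hz1, hz2⟩) (ihb ?_ ?_ hW)
    · refine ⟨fun h => ?_, fun h => absurd h hz1, hz2⟩
      cases b <;> simp [innerLabel] at h
    · rintro rfl
      simp [Adj, innerLabel]
    · intro h
      simp [innerLabel_of_ne h]

theorem isChain_cons_rightLabels (T : BinaryTree Unit) {z : Label}
    (h : z = lft ∨ z = spineLabel T) : (z :: rightLabels T).IsChain Adj := by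
  induction T generalizing z with
  | nil => exact .singleton _
  | node v a b iha ihb =>
    refine isChain_cons_innerLabels a ?_ ?_ (ihb (.inr rfl))
    · rintro rfl
      match b with
      | .nil => rcases h with rfl | rfl <;> simp [Adj, spineLabel]
      | .node _ .nil _ => rcases h with rfl | rfl <;> simp [Adj, spineLabel]
      | .node _ (.node _ _ _) _ => rcases h with rfl | rfl <;> simp [Adj, spineLabel]
    · intro ha
      cases a with
      | nil => exact absurd rfl ha
      | node w c d => rcases h with rfl | rfl <;> simp [spineLabel]

theorem isChain_leftLabels_append (T : BinaryTree Unit) {W : List Label}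
    (h : (lft :: W).IsChain Adj) : (leftLabels T ++ lft :: W).IsChain Adj := by
  induction T generalizing W with
  | nil => exact h
  | node v a b iha ihb =>
    have := iha (W := innerLabels b ++ lft :: W)
      (isChain_cons_innerLabels b (fun _ => by simp [Adj]) (fun _ => by simp) h)
    simpa [leftLabels] using this

theorem isChain_labels (T : BinaryTree Unit) : (labels T).IsChain Adj := by
  cases T with
  | nil => exact .nil
  | node v l r => exact isChain_leftLabels_append l (isChain_cons_rightLabels r (.inl rfl))

theorem adj_of_labels_eq {T : BinaryTree Unit} {U V : List Label} {y z : Label}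
    (h : labels T = U ++ y :: z :: V) : Adj y z := by
  have := isChain_labels T
  rw [h, List.isChain_append_cons_cons] at this
  exact this.2.1

theorem labels_head {T : BinaryTree Unit} (h : T ≠ .nil) : ∃ V, labels T = lft :: V := by
  have key : ∀ T : BinaryTree Unit, ∀ W, ∃ V, leftLabels T ++ lft :: W = lft :: V := by
    intro T
    induction T with
    | nil => exact fun W => ⟨W, rfl⟩
    | node v a b iha ihb =>
      intro W
      obtain ⟨V, hV⟩ := iha (innerLabels b ++ lft :: W)
      exact ⟨V, by simpa [leftLabels] using hV⟩
  cases T with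
  | nil => exact absurd rfl h
  | node v l r => exact key l _

/-! ### Detecting expansions -/

/-- The leaf after a space `inn` is a right child. If its sibling subtree is a leaf, the two form a
caret that can be removed; otherwise that subtree ends in a right child, and the preceding label is
`inn` as well. -/
theorem innerLabels_eq_expand {T : BinaryTree Unit} {U V : List Label}
    (h : innerLabels T = U ++ inn :: V) (hU : ∀ U', U ≠ U' ++ [inn]) :
    ∃ T₀, T = expand U.length T₀ ∧ U.length < T₀.numLeaves := by
  induction T generalizing U V with
  | nil => simp [innerLabels] at h
  | node v a b iha ihb =>
    have ha := length_innerLabels a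
    rw [innerLabels, List.append_eq_append_iff] at h
    rcases h with ⟨A, hA, hB⟩ | ⟨A, hA, hB⟩
    · cases A with
      | nil =>
        simp only [List.append_nil, List.nil_append, List.cons.injEq] at hA hB
        have hb : b = .nil := by
          cases b with
          | nil => rfl
          | node => simp [innerLabel] at hB
        by_cases ha0 : a = .nil
        · subst ha0 hb
          exact ⟨.nil, by simp [expand], by simp [hA, innerLabels]⟩
        · obtain ⟨U', hU'⟩ := innerLabels_last ha0
          exact absurd (hA.trans hU') (hU U')
      | cons x A =>
        simp only [List.cons_append, List.cons.injEq] at hB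
        obtain ⟨T₀, h1, h2⟩ := ihb hB.2 (by
          rintro U' rfl
          exact hU (innerLabels a ++ x :: U') (by simp [hA]))
        refine ⟨caret a T₀, ?_, ?_⟩
        · rw [show U.length = a.numLeaves + A.length by simp [hA]; omega, expand_right, ← h1]
        · simp [hA, BinaryTree.numLeaves]; omega
    · cases A with
      | nil =>
        simp only [List.append_nil, List.nil_append, List.cons.injEq] at hA hB
        have hb : b = .nil := by
          cases b with
          | nil => rfl
          | node => simp [innerLabel] at hB
        by_cases ha0 : a = .nil
        · subst ha0 hb
          exact ⟨.nil, by simp [expand], by simp [← hA, innerLabels]⟩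
        · obtain ⟨U', hU'⟩ := innerLabels_last ha0
          exact absurd (hA.symm.trans hU') (hU U')
      | cons x A =>
        simp only [List.cons_append, List.cons.injEq] at hB
        obtain ⟨T₀, h1, h2⟩ := iha (by rw [hA, hB.1]) hU
        exact ⟨caret T₀ b, by rw [expand_left b h2, ← h1], by
          simp [BinaryTree.numLeaves]; omega⟩

theorem rightLabels_eq_expand {T : BinaryTree Unit} {U V : List Label}
    (h : rightLabels T = U ++ inn :: V) (hU : ∀ U', U ≠ U' ++ [inn]) :
    ∃ T₀, T = expand U.length T₀ ∧ U.length < T₀.numLeaves := by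
  induction T generalizing U V with
  | nil => simp [rightLabels] at h
  | node v a b iha ihb =>
    have ha := length_innerLabels a
    have hk : spineLabel b ≠ inn := by
      match b with
      | .nil => simp [spineLabel]
      | .node _ .nil _ => simp [spineLabel]
      | .node _ (.node _ _ _) _ => simp [spineLabel]
    rw [rightLabels, List.append_eq_append_iff] at h
    rcases h with ⟨A, hA, hB⟩ | ⟨A, hA, hB⟩
    · cases A with
      | nil =>
        simp only [List.nil_append, List.cons.injEq] at hB
        exact absurd hB.1 hk
      | cons x A =>
        simp only [List.cons_append, List.cons.injEq] at hB
        obtain ⟨T₀, h1, h2⟩ := ihb hB.2 (by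
          rintro U' rfl
          exact hU (innerLabels a ++ x :: U') (by simp [hA]))
        refine ⟨caret a T₀, ?_, ?_⟩
        · rw [show U.length = a.numLeaves + A.length by simp [hA]; omega, expand_right, ← h1]
        · simp [hA, BinaryTree.numLeaves]; omega
    · cases A with
      | nil =>
        simp only [List.nil_append, List.cons.injEq] at hB
        exact absurd hB.1.symm hk
      | cons x A =>
        simp only [List.cons_append, List.cons.injEq] at hB
        obtain ⟨T₀, h1, h2⟩ := innerLabels_eq_expand (by rw [hA, hB.1]) hU
        exact ⟨caret T₀ b, by rw [expand_left b h2, ← h1], by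
          simp [BinaryTree.numLeaves]; omega⟩

theorem leftLabels_eq_expand {T : BinaryTree Unit} {U V : List Label}
    (h : leftLabels T = U ++ inn :: V) (hU : ∀ U', U ≠ U' ++ [inn]) :
    ∃ T₀, T = expand U.length T₀ ∧ U.length < T₀.numLeaves := by
  induction T generalizing U V with
  | nil => simp [leftLabels] at h
  | node v a b iha ihb =>
    have ha := length_leftLabels a
    rw [leftLabels, List.append_eq_append_iff] at h
    rcases h with ⟨A, hA, hB⟩ | ⟨A, hA, hB⟩
    · cases A with
      | nil => simp at hB
      | cons x A =>
        simp only [List.cons_append, List.cons.injEq] at hB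
        obtain ⟨T₀, h1, h2⟩ := innerLabels_eq_expand hB.2 (by
          rintro U' rfl
          exact hU (leftLabels a ++ x :: U') (by simp [hA]))
        refine ⟨caret a T₀, ?_, ?_⟩
        · rw [show U.length = a.numLeaves + A.length by simp [hA]; omega, expand_right, ← h1]
        · simp [hA, BinaryTree.numLeaves]; omega
    · cases A with
      | nil => simp at hB
      | cons x A =>
        simp only [List.cons_append, List.cons.injEq] at hB
        obtain ⟨T₀, h1, h2⟩ := iha (by rw [hA, hB.1]) hU
        exact ⟨caret T₀ b, by rw [expand_left b h2, ← h1], by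
          simp [BinaryTree.numLeaves]; omega⟩

/-- A leaf before a space with label `inn` is a left child unless the preceding label is
`inn`, too. -/
theorem labels_eq_expand {T : BinaryTree Unit} {U V : List Label}
    (h : labels T = U ++ inn :: V) (hU : ∀ U', U ≠ U' ++ [inn]) :
    ∃ T₀, T = expand U.length T₀ ∧ U.length < T₀.numLeaves := by
  cases T with
  | nil => simp [labels] at h
  | node v a b =>
    have ha := length_leftLabels a
    rw [labels, List.append_eq_append_iff] at h
    rcases h with ⟨A, hA, hB⟩ | ⟨A, hA, hB⟩
    · cases A with
      | nil => simp at hB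
      | cons x A =>
        simp only [List.cons_append, List.cons.injEq] at hB
        obtain ⟨T₀, h1, h2⟩ := rightLabels_eq_expand hB.2 (by
          rintro U' rfl
          exact hU (leftLabels a ++ x :: U') (by simp [hA]))
        refine ⟨caret a T₀, ?_, ?_⟩
        · rw [show U.length = a.numLeaves + A.length by simp [hA]; omega, expand_right, ← h1]
        · simp [hA, BinaryTree.numLeaves]; omega
    · cases A with
      | nil => simp at hB
      | cons x A =>
        simp only [List.cons_append, List.cons.injEq] at hB
        obtain ⟨T₀, h1, h2⟩ := leftLabels_eq_expand (by rw [hA, hB.1]) hU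
        exact ⟨caret T₀ b, by rw [expand_left b h2, ← h1], by
          simp [BinaryTree.numLeaves]; omega⟩

/-- The last leaf is the right child at the end of the right spine. Either its sibling is a leaf
too, or the sibling is a nontrivial tree, whose last interior label is `inn`. -/
theorem rightLabels_fin {T : BinaryTree Unit} (h : T ≠ .nil) :
    (∃ U, rightLabels T = U ++ [inn, fin]) ∨
      ∃ T₀, T = expand (T₀.numLeaves - 1) T₀ := by
  induction T with
  | nil => exact absurd rfl h
  | node v a b iha ihb =>
    by_cases hb : b = .nil
    · subst hb
      by_cases ha : a = .nil
      · subst ha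
        exact .inr ⟨.nil, rfl⟩
      · obtain ⟨U, hU⟩ := innerLabels_last ha
        exact .inl ⟨U, by simp [rightLabels, hU, spineLabel]⟩
    · rcases ihb hb with ⟨U, hU⟩ | ⟨T₀, hT⟩
      · exact .inl ⟨innerLabels a ++ spineLabel b :: U, by simp [rightLabels, hU]⟩
      · refine .inr ⟨caret a T₀, ?_⟩
        have := T₀.numLeaves_pos
        rw [show (caret a T₀).numLeaves - 1 = a.numLeaves + (T₀.numLeaves - 1) by
          simp only [BinaryTree.numLeaves]; omega, expand_right, ← hT]

theorem labels_fin {T : BinaryTree Unit} {U : List Label} {y : Label}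
    (h : labels T = U ++ [y, fin]) :
    y = inn ∨ ∃ T₀, T₀ ≠ .nil ∧ T = expand (T₀.numLeaves - 1) T₀ := by
  cases T with
  | nil => simp [labels] at h
  | node v l r =>
    by_cases hr : r = .nil
    · subst hr
      have := congrArg List.getLast? h
      simp [labels, rightLabels] at this
    · rcases rightLabels_fin hr with ⟨U', hU⟩ | ⟨T₀, hT⟩
      · rw [labels, hU] at h
        have h' : (leftLabels l ++ lft :: U') ++ [inn, fin] = U ++ [y, fin] := by simpa using h
        have := List.append_inj_right' h' rfl
        simp only [List.cons.injEq, and_true] at this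
        exact .inl this.symm
      · refine .inr ⟨caret l T₀, by simp, ?_⟩
        have := T₀.numLeaves_pos
        rw [show (caret l T₀).numLeaves - 1 = l.numLeaves + (T₀.numLeaves - 1) by
          simp only [BinaryTree.numLeaves]; omega, expand_right, ← hT]

/-- Two exterior spaces in a row enclose a trivial tree, so the lowest caret of the left spine has
two leaves as children. -/
theorem labels_lft_lft {T : BinaryTree Unit} {V : List Label}
    (h : labels T = lft :: lft :: V) : ∃ T₀, T₀ ≠ .nil ∧ T = expand 0 T₀ := by
  have key : ∀ T : BinaryTree Unit, T ≠ .nil → ∀ W V,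
      leftLabels T ++ lft :: W = lft :: lft :: V → ∃ T₀, T = expand 0 T₀ := by
    intro T
    induction T with
    | nil => exact fun h => absurd rfl h
    | node v a b iha ihb =>
      intro _ W V hV
      simp only [leftLabels, List.append_assoc, List.cons_append] at hV
      by_cases ha : a = .nil
      · subst ha
        simp only [leftLabels, List.nil_append, List.cons.injEq, true_and] at hV
        by_cases hb : b = .nil
        · subst hb; exact ⟨.nil, rfl⟩
        · cases hB : innerLabels b with
          | nil =>
            have := length_innerLabels b
            rw [hB] at this
            have := ne_nil_iff.1 hb
            simp at *; omega
          | cons x A =>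
            rw [hB, List.cons_append, List.cons.injEq] at hV
            have := innerLabels_mem b x (by simp [hB])
            simp [hV.1] at this
      · obtain ⟨T₀, hT⟩ := iha ha _ _ hV
        exact ⟨caret T₀ b, by rw [expand_left b T₀.numLeaves_pos, ← hT]⟩
  cases T with
  | nil => simp [labels] at h
  | node v l r =>
    by_cases hl : l = .nil
    · subst hl
      simp only [labels, leftLabels, List.nil_append, List.cons.injEq, true_and] at h
      cases r with
      | nil => simp [rightLabels] at h
      | node w a b =>
        exfalso
        have hk : spineLabel b ≠ lft := by
          match b with
          | .nil => simp [spineLabel]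
          | .node _ .nil _ => simp [spineLabel]
          | .node _ (.node _ _ _) _ => simp [spineLabel]
        rw [rightLabels] at h
        cases hA : innerLabels a with
        | nil => rw [hA] at h; simp [hk] at h
        | cons x A =>
          rw [hA, List.cons_append, List.cons.injEq] at h
          have := innerLabels_mem a x (by simp [hA])
          simp [h.1] at this
    · obtain ⟨T₀, hT⟩ := key l hl _ _ h
      exact ⟨caret T₀ r, by simp, by rw [expand_left r T₀.numLeaves_pos, ← hT]⟩

theorem labels_last {T : BinaryTree Unit} {U : List Label} {y : Label}
    (h : labels T = U ++ [y]) : y = lft ∨ y = fin := by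
  have hT : T ≠ .nil := by rintro rfl; simp [labels] at h
  obtain ⟨U', y', hy, h', -⟩ := labels_expand_last hT
  have := congrArg List.getLast? (h.symm.trans h')
  simp at this
  exact this ▸ hy

end Thompson

namespace Thompson

/-! ### Tree diagrams of products and inverses -/

theorem HasTreeDiagram.length_eq {f : I ≃ₜ I} {D R : BinaryTree Unit}
    (h : HasTreeDiagram f D R) : D.numLeaves = R.numLeaves := by
  rw [← length_leaves D 0 1, ← length_leaves R 0 1]
  exact List.Forall₂.length_eq h

theorem HasTreeDiagram.symm {f : I ≃ₜ I} {D R : BinaryTree Unit} (h : HasTreeDiagram f D R) :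
    HasTreeDiagram f.symm R D := by
  have h' : List.Forall₂ (fun J K => MapsLinearly f J K ∧ J ∈ leaves D 0 1)
      (leaves D 0 1) (leaves R 0 1) := by
    unfold HasTreeDiagram at h
    rw [List.forall₂_iff_get] at h ⊢
    exact ⟨h.1, fun i h1 h2 => ⟨h.2 i h1 h2, List.get_mem _ _⟩⟩
  refine List.Forall₂.flip (h'.imp ?_)
  rintro J K ⟨hJK, hJ⟩ s h0 h1 y hy
  obtain ⟨h2, h3, h4⟩ := leaves_mem_Icc D 0 1 zero_le_one J hJ
  have hx : (1 - s) * J.1 + s * J.2 ∈ I := ⟨by nlinarith, by nlinarith⟩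
  have := hJK s h0 h1 ⟨_, hx⟩ rfl
  have hfy : f ⟨_, hx⟩ = y := Subtype.ext (by rw [this, hy])
  rw [← hfy, Homeomorph.symm_apply_apply]

theorem MapsLinearly.mul {f g : F} {J K M : ℝ × ℝ} (hf : MapsLinearly (toHomeo f) J K)
    (hg : MapsLinearly (toHomeo g) K M) : MapsLinearly (toHomeo (f * g)) J M :=
  fun s h0 h1 x hx => hg s h0 h1 _ (hf s h0 h1 x hx)

theorem forall₂_mul {f g : F} {A B C : List (ℝ × ℝ)}
    (hf : List.Forall₂ (MapsLinearly (toHomeo f)) A B)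
    (hg : List.Forall₂ (MapsLinearly (toHomeo g)) B C) :
    List.Forall₂ (MapsLinearly (toHomeo (f * g))) A C := by
  induction hf generalizing C with
  | nil => cases hg; exact .nil
  | cons h _ ih =>
    cases hg with
    | cons h' hg => exact .cons (h.mul h') (ih hg)

theorem HasTreeDiagram.mul {f g : F} {T U V : BinaryTree Unit}
    (hf : HasTreeDiagram (toHomeo f) T U) (hg : HasTreeDiagram (toHomeo g) U V) :
    HasTreeDiagram (toHomeo (f * g)) T V :=
  forall₂_mul hf hg

theorem HasTreeDiagram.inv {f : F} {D R : BinaryTree Unit}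
    (h : HasTreeDiagram (toHomeo f) D R) : HasTreeDiagram (toHomeo f⁻¹) R D :=
  HasTreeDiagram.symm h

/-- Grafting the same trees onto both sides puts `x0` in a form that composes with any diagram whose
source tree has the required top carets. -/
theorem hasTreeDiagram_x0 (l a b : BinaryTree Unit) :
    HasTreeDiagram (toHomeo x0) (caret (caret l a) b) (caret l (caret a b)) := by
  have h := x0Homeo_hasTreeDiagram
  simp only [HasTreeDiagram, leaves, List.cons_append, List.nil_append, List.forall₂_cons] at h
  obtain ⟨h1, h2, h3, -⟩ := h
  simp only [HasTreeDiagram, leaves, List.append_assoc]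
  exact List.rel_append (h1.leaves l) (List.rel_append (h2.leaves a) (h3.leaves b))

theorem hasTreeDiagram_x1 (l a b c : BinaryTree Unit) :
    HasTreeDiagram (toHomeo x1) (caret l (caret (caret a b) c)) (caret l (caret a (caret b c))) := by
  have h := x1Homeo_hasTreeDiagram
  simp only [HasTreeDiagram, leaves, List.cons_append, List.nil_append, List.forall₂_cons] at h
  obtain ⟨h1, h2, h3, h4, -⟩ := h
  simp only [HasTreeDiagram, leaves, List.append_assoc]
  exact List.rel_append (h1.leaves l) (List.rel_append (h2.leaves a)
    (List.rel_append (h3.leaves b) (h4.leaves c)))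

theorem exists_hasTreeDiagram (f : F) : ∃ D R, HasTreeDiagram (toHomeo f) D R := f.2

/-! ### Expanding and reducing tree diagrams -/

/-- The left half of an interval. -/
noncomputable def lhalf (J : ℝ × ℝ) : ℝ × ℝ := (J.1, (J.1 + J.2) / 2)

/-- The right half of an interval. -/
noncomputable def rhalf (J : ℝ × ℝ) : ℝ × ℝ := ((J.1 + J.2) / 2, J.2)

theorem MapsLinearly.lhalf {f : I ≃ₜ I} {J K : ℝ × ℝ} (h : MapsLinearly f J K) :
    MapsLinearly f (lhalf J) (lhalf K) := by
  intro s h0 h1 x hx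
  rw [h (s / 2) (by linarith) (by linarith) x (by rw [hx]; simp only [Thompson.lhalf]; ring)]
  simp only [Thompson.lhalf]; ring

theorem MapsLinearly.rhalf {f : I ≃ₜ I} {J K : ℝ × ℝ} (h : MapsLinearly f J K) :
    MapsLinearly f (rhalf J) (rhalf K) := by
  intro s h0 h1 x hx
  rw [h ((1 + s) / 2) (by linarith) (by linarith) x
    (by rw [hx]; simp only [Thompson.rhalf]; ring)]
  simp only [Thompson.rhalf]; ring

theorem MapsLinearly.of_halves {f : I ≃ₜ I} {J K : ℝ × ℝ}
    (h : MapsLinearly f (Thompson.lhalf J) (Thompson.lhalf K))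
    (h' : MapsLinearly f (Thompson.rhalf J) (Thompson.rhalf K)) : MapsLinearly f J K := by
  intro s h0 h1 x hx
  rcases le_total s (1 / 2) with hs | hs
  · rw [h (2 * s) (by linarith) (by linarith) x (by rw [hx]; simp only [Thompson.lhalf]; ring)]
    simp only [Thompson.lhalf]; ring
  · rw [h' (2 * s - 1) (by linarith) (by linarith) x
      (by rw [hx]; simp only [Thompson.rhalf]; ring)]
    simp only [Thompson.rhalf]; ring

theorem leaves_expand {i : ℕ} {T : BinaryTree Unit} (h : i < T.numLeaves) (a b : ℝ) :
    ∃ A J B, leaves T a b = A ++ J :: B ∧ A.length = i ∧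
      leaves (expand i T) a b = A ++ lhalf J :: rhalf J :: B := by
  induction T generalizing i a b with
  | nil =>
    obtain rfl : i = 0 := by simpa using h
    exact ⟨[], (a, b), [], rfl, rfl, rfl⟩
  | node v l r ihl ihr =>
    by_cases hi : i < l.numLeaves
    · obtain ⟨A, J, B, h1, h2, h3⟩ := ihl hi a ((a + b) / 2)
      exact ⟨A, J, B ++ leaves r ((a + b) / 2) b, by simp [leaves, h1], h2, by
        simp [expand_left r hi, leaves, h3]⟩
    · obtain ⟨j, rfl⟩ := Nat.exists_eq_add_of_le (not_lt.1 hi)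
      simp only [BinaryTree.numLeaves] at h
      obtain ⟨A, J, B, h1, h2, h3⟩ := ihr (show j < r.numLeaves by omega) ((a + b) / 2) b
      exact ⟨leaves l a ((a + b) / 2) ++ A, J, B, by simp [leaves, h1], by
        simp [length_leaves, h2], by rw [expand_right]; simp [leaves, h3]⟩

theorem forall₂_append_iff {α β : Type*} {P : α → β → Prop} {A A' : List α} {B B' : List β}
    (h : A.length = B.length) :
    List.Forall₂ P (A ++ A') (B ++ B') ↔ List.Forall₂ P A B ∧ List.Forall₂ P A' B' := by
  induction A generalizing B with
  | nil => cases B <;> simp at h ⊢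
  | cons a A ih =>
    cases B with
    | nil => simp at h
    | cons b B => simp [ih (by simpa using h), and_assoc]

theorem hasTreeDiagram_expand_iff {f : I ≃ₜ I} {D R : BinaryTree Unit} {i : ℕ}
    (hD : i < D.numLeaves) (hR : i < R.numLeaves) :
    HasTreeDiagram f (expand i D) (expand i R) ↔ HasTreeDiagram f D R := by
  obtain ⟨A, J, B, h1, h2, h3⟩ := leaves_expand hD 0 1
  obtain ⟨A', J', B', h1', h2', h3'⟩ := leaves_expand hR 0 1
  unfold HasTreeDiagram
  rw [h1, h3, h1', h3', forall₂_append_iff (by omega), forall₂_append_iff (by omega)]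
  simp only [List.forall₂_cons]
  exact ⟨fun ⟨k1, k2, k3, k4⟩ => ⟨k1, k2.of_halves k3, k4⟩,
    fun ⟨k1, k2, k3⟩ => ⟨k1, k2.lhalf, k2.rhalf, k3⟩⟩

/-! ### Standard dyadic intervals -/

/-- The interval reached from `J` by the given choices of right halves. -/
noncomputable def sub : List Bool → ℝ × ℝ → ℝ × ℝ
  | [], J => J
  | false :: p, J => sub p (lhalf J)
  | true :: p, J => sub p (rhalf J)

theorem sub_append (p q : List Bool) (J : ℝ × ℝ) : sub (p ++ q) J = sub q (sub p J) := by
  induction p generalizing J with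
  | nil => rfl
  | cons x p ih => cases x <;> exact ih _

theorem MapsLinearly.sub {f : I ≃ₜ I} {J K : ℝ × ℝ} (h : MapsLinearly f J K) (p : List Bool) :
    MapsLinearly f (sub p J) (sub p K) := by
  induction p generalizing J K with
  | nil => exact h
  | cons x p ih => cases x; exacts [ih h.lhalf, ih h.rhalf]

theorem sub_bounds (p : List Bool) {J : ℝ × ℝ} (h : J.1 < J.2) :
    J.1 ≤ (sub p J).1 ∧ (sub p J).1 < (sub p J).2 ∧ (sub p J).2 ≤ J.2 := by
  induction p generalizing J with
  | nil => exact ⟨le_rfl, h, le_rfl⟩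
  | cons x p ih =>
    cases x
    · have := ih (J := lhalf J) (by simp only [lhalf]; linarith)
      simp only [lhalf] at this
      exact ⟨this.1, this.2.1, by simp only [sub, lhalf]; linarith⟩
    · have := ih (J := rhalf J) (by simp only [rhalf]; linarith)
      simp only [rhalf] at this
      exact ⟨by simp only [sub, rhalf]; linarith, this.2.1, this.2.2⟩

/-- At the first place where two paths differ, one interval lies in the left half and the other in
the right half; a proper extension of a path gives a strictly smaller interval. -/
theorem sub_injective {p q : List Bool} {J : ℝ × ℝ} (h : J.1 < J.2) (e : sub p J = sub q J) :
    p = q := by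
  have hl : (lhalf J).1 < (lhalf J).2 := by simp only [lhalf]; linarith
  have hr : (rhalf J).1 < (rhalf J).2 := by simp only [rhalf]; linarith
  induction p generalizing q J with
  | nil =>
    match q with
    | [] => rfl
    | false :: q =>
      have := sub_bounds q hl
      rw [← show sub (false :: q) J = sub q (lhalf J) from rfl, ← e] at this
      simp only [sub, lhalf] at this
      linarith
    | true :: q =>
      have := sub_bounds q hr
      rw [← show sub (true :: q) J = sub q (rhalf J) from rfl, ← e] at this
      simp only [sub, rhalf] at this
      linarith
  | cons x p ih =>
    have bl := sub_bounds p hl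
    have br := sub_bounds p hr
    match x, q with
    | false, [] =>
      rw [← show sub (false :: p) J = sub p (lhalf J) from rfl, e] at bl
      simp only [sub, lhalf] at bl
      linarith
    | true, [] =>
      rw [← show sub (true :: p) J = sub p (rhalf J) from rfl, e] at br
      simp only [sub, rhalf] at br
      linarith
    | false, false :: q =>
      rw [ih hl e (by simp only [lhalf] at *; linarith) (by simp only [lhalf, rhalf] at *; linarith)]
    | true, true :: q =>
      rw [ih hr e (by simp only [lhalf, rhalf] at *; linarith) (by simp only [rhalf] at *; linarith)]
    | false, true :: q =>
      have := sub_bounds q hr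
      change sub p (lhalf J) = sub q (rhalf J) at e
      rw [e] at bl
      simp only [lhalf, rhalf] at *
      linarith
    | true, false :: q =>
      have := sub_bounds q hl
      change sub p (rhalf J) = sub q (lhalf J) at e
      rw [e] at br
      simp only [lhalf, rhalf] at *
      linarith

/-- A standard dyadic interval: one that occurs in dyadic subdivisions of `[0, 1]`. -/
def IsStandard (K : ℝ × ℝ) : Prop := ∃ p, K = sub p (0, 1)

theorem IsStandard.sub {K : ℝ × ℝ} (h : IsStandard K) (p : List Bool) :
    IsStandard (sub p K) := by
  obtain ⟨q, rfl⟩ := h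
  exact ⟨q ++ p, (sub_append _ _ _).symm⟩

theorem IsStandard.lhalf {K : ℝ × ℝ} (h : IsStandard K) : IsStandard (lhalf K) := h.sub [false]

theorem IsStandard.rhalf {K : ℝ × ℝ} (h : IsStandard K) : IsStandard (rhalf K) := h.sub [true]

theorem IsStandard.lt {K : ℝ × ℝ} (h : IsStandard K) : K.1 < K.2 := by
  obtain ⟨q, rfl⟩ := h
  exact (sub_bounds q (by simp)).2.1

/-- The path of a standard interval is unique, and here the last steps differ. -/
theorem IsStandard.lhalf_ne_rhalf {K M : ℝ × ℝ} (hK : IsStandard K) (hM : IsStandard M) :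
    Thompson.lhalf K ≠ Thompson.rhalf M := by
  obtain ⟨p, rfl⟩ := hK
  obtain ⟨q, rfl⟩ := hM
  intro e
  have : Thompson.sub (p ++ [false]) (0, 1) = Thompson.sub (q ++ [true]) (0, 1) := by
    rw [sub_append, sub_append]; exact e
  have := sub_injective (by simp) this
  simpa using congrArg List.getLast? this

theorem exists_eq_sub_of_mem_leaves {T : BinaryTree Unit} {a b : ℝ} {J : ℝ × ℝ}
    (h : J ∈ leaves T a b) : ∃ p, J = sub p (a, b) := by
  induction T generalizing a b with
  | nil => exact ⟨[], by simpa [leaves, sub] using h⟩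
  | node v l r ihl ihr =>
    rcases List.mem_append.1 h with h | h
    · obtain ⟨p, hp⟩ := ihl h
      exact ⟨false :: p, hp⟩
    · obtain ⟨p, hp⟩ := ihr h
      exact ⟨true :: p, hp⟩

theorem eq_nil_of_mem_leaves {T : BinaryTree Unit} {a b : ℝ} (hab : a < b)
    (h : (a, b) ∈ leaves T a b) : T = .nil := by
  cases T with
  | nil => rfl
  | node v l r =>
    rcases List.mem_append.1 h with h | h
    · have := leaves_mem_Icc _ _ _ (by linarith) _ h
      simp only at this; linarith
    · have := leaves_mem_Icc _ _ _ (by linarith) _ h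
      simp only at this; linarith

/-- Two adjacent leaves that are the halves of a standard dyadic interval belong to a caret. -/
theorem eq_expand_of_getElem? {R : BinaryTree Unit} {a b : ℝ} (hab : a < b) {p : List Bool}
    {i : ℕ} (h : (leaves R a b)[i]? = some (lhalf (sub p (a, b))))
    (h' : (leaves R a b)[i + 1]? = some (rhalf (sub p (a, b)))) :
    ∃ R₀, R = expand i R₀ ∧ i < R₀.numLeaves := by
  induction R generalizing a b p i with
  | nil => simp [leaves] at h'
  | node v l r ihl ihr =>
    have m1 : a < (a + b) / 2 := by linarith
    have m2 : (a + b) / 2 < b := by linarith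
    have memL := List.mem_of_getElem? h
    have memR := List.mem_of_getElem? h'
    have hl : ∀ J ∈ leaves l a ((a + b) / 2), J.1 < (a + b) / 2 := by
      intro J hJ
      obtain ⟨q, rfl⟩ := exists_eq_sub_of_mem_leaves hJ
      have := sub_bounds q (J := (a, (a + b) / 2)) m1
      simp only at this; linarith
    have hr : ∀ J ∈ leaves r ((a + b) / 2) b, (a + b) / 2 ≤ J.1 := fun J hJ =>
      (leaves_mem_Icc _ _ _ m2.le _ hJ).1
    have lenl := length_leaves l a ((a + b) / 2)
    match p with
    | [] =>
      have el : l = .nil := by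
        refine eq_nil_of_mem_leaves m1 ?_
        rcases List.mem_append.1 memL with h | h
        · exact h
        · have := hr _ h
          simp only [sub, lhalf] at this; linarith
      have er : r = .nil := by
        refine eq_nil_of_mem_leaves m2 ?_
        rcases List.mem_append.1 memR with h | h
        · have := hl _ h
          simp only [sub, rhalf] at this; linarith
        · exact h
      subst el er
      obtain rfl : i = 0 := by
        by_contra hi
        obtain ⟨j, rfl⟩ := Nat.exists_eq_succ_of_ne_zero hi
        simp [leaves] at h'
      exact ⟨.nil, rfl, by simp⟩
    | false :: p =>
      have k := sub_bounds p (J := (a, (a + b) / 2)) m1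
      have e : sub (false :: p) (a, b) = sub p (a, (a + b) / 2) := rfl
      rw [e] at h h' memL memR
      set K := sub p (a, (a + b) / 2) with hK
      simp only at k
      have i1 : i + 1 < l.numLeaves := by
        by_contra hi
        rw [leaves, List.getElem?_append_right (by omega)] at h'
        have := hr _ (List.mem_of_getElem? h')
        simp only [rhalf] at this; linarith
      rw [leaves, List.getElem?_append_left (by omega)] at h h'
      obtain ⟨l₀, h1, h2⟩ := ihl m1 h h'
      exact ⟨caret l₀ r, by rw [expand_left r h2, ← h1], by simp [BinaryTree.numLeaves]; omega⟩
    | true :: p =>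
      have k := sub_bounds p (J := ((a + b) / 2, b)) m2
      have e : sub (true :: p) (a, b) = sub p ((a + b) / 2, b) := rfl
      rw [e] at h h' memL memR
      set K := sub p ((a + b) / 2, b) with hK
      simp only at k
      have i1 : l.numLeaves ≤ i := by
        by_contra hi
        rw [leaves, List.getElem?_append_left (by omega)] at h
        have := hl _ (List.mem_of_getElem? h)
        simp only [lhalf] at this; linarith
      obtain ⟨j, rfl⟩ := Nat.exists_eq_add_of_le i1
      rw [leaves, List.getElem?_append_right (by omega), lenl, Nat.add_sub_cancel_left] at h
      rw [leaves, List.getElem?_append_right (by omega), lenl, Nat.add_assoc,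
        Nat.add_sub_cancel_left] at h'
      obtain ⟨r₀, h1, h2⟩ := ihr m2 h h'
      exact ⟨caret l r₀, by rw [expand_right, ← h1], by simp [BinaryTree.numLeaves]; omega⟩

theorem MapsLinearly.unique {f : I ≃ₜ I} {J K M : ℝ × ℝ} (h0 : 0 ≤ J.1) (hJ : J.1 < J.2)
    (h1 : J.2 ≤ 1) (hK : MapsLinearly f J K) (hM : MapsLinearly f J M) : K = M := by
  have a1 := hK 0 le_rfl zero_le_one ⟨J.1, h0, by linarith⟩ (by simp)
  have a2 := hM 0 le_rfl zero_le_one ⟨J.1, h0, by linarith⟩ (by simp)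
  have b1 := hK 1 zero_le_one le_rfl ⟨J.2, by linarith, h1⟩ (by simp)
  have b2 := hM 1 zero_le_one le_rfl ⟨J.2, by linarith, h1⟩ (by simp)
  refine Prod.ext ?_ ?_
  · linarith
  · linarith

theorem HasTreeDiagram.getElem? {f : I ≃ₜ I} {D R : BinaryTree Unit} (h : HasTreeDiagram f D R)
    {i : ℕ} {J K : ℝ × ℝ} (hJ : (Thompson.leaves D 0 1)[i]? = some J) (hK : MapsLinearly f J K) :
    (Thompson.leaves R 0 1)[i]? = some K := by
  obtain ⟨p, hp⟩ := exists_eq_sub_of_mem_leaves (List.mem_of_getElem? hJ)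
  have hb := sub_bounds p (J := ((0 : ℝ), (1 : ℝ))) (by simp)
  rw [← hp] at hb
  unfold HasTreeDiagram at h
  obtain ⟨hi, rfl⟩ := List.getElem?_eq_some_iff.1 hJ
  have hi' : i < (Thompson.leaves R 0 1).length := h.length_eq ▸ hi
  have := (List.forall₂_iff_get.1 h).2 i hi hi'
  rw [List.getElem?_eq_getElem hi', this.unique hb.1 hb.2.1 hb.2.2 hK |>.symm]
  rfl

theorem HasTreeDiagram.exists_maps {f : I ≃ₜ I} {D R : BinaryTree Unit}
    (h : HasTreeDiagram f D R) {J : ℝ × ℝ} (hJ : J ∈ Thompson.leaves D 0 1) :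
    ∃ K, IsStandard K ∧ MapsLinearly f J K := by
  obtain ⟨i, hi, rfl⟩ := List.getElem_of_mem hJ
  have hi' : i < (Thompson.leaves R 0 1).length := List.Forall₂.length_eq h ▸ hi
  exact ⟨_, exists_eq_sub_of_mem_leaves (List.getElem_mem hi'),
    (List.forall₂_iff_get.1 h).2 i hi hi'⟩

theorem HasTreeDiagram.eq_expand {f : I ≃ₜ I} {D R : BinaryTree Unit} (h : HasTreeDiagram f D R)
    {i : ℕ} {J J' K : ℝ × ℝ} (hJ : (Thompson.leaves D 0 1)[i]? = some J)
    (hJ' : (Thompson.leaves D 0 1)[i + 1]? = some J') (hK : IsStandard K)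
    (m : MapsLinearly f J (lhalf K)) (m' : MapsLinearly f J' (rhalf K)) :
    ∃ R₀, R = expand i R₀ ∧ i < R₀.numLeaves := by
  obtain ⟨p, rfl⟩ := hK
  exact eq_expand_of_getElem? zero_lt_one (h.getElem? hJ m) (h.getElem? hJ' m')

/-- Any lowest caret will do. Its path `q` does not depend on the ambient interval, so the caret can
still be located when the tree sits inside a larger one. -/
theorem exists_expand {T : BinaryTree Unit} (h : T ≠ .nil) :
    ∃ i q T₀, T = expand i T₀ ∧ i < T₀.numLeaves ∧
      ∀ a b, (leaves T₀ a b)[i]? = some (sub q (a, b)) := by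
  induction T with
  | nil => exact absurd rfl h
  | node v a b iha ihb =>
    by_cases ha : a = .nil
    · by_cases hb : b = .nil
      · subst ha hb
        exact ⟨0, [], .nil, rfl, by simp, fun _ _ => rfl⟩
      · obtain ⟨i, q, T₀, h1, h2, h3⟩ := ihb hb
        refine ⟨a.numLeaves + i, true :: q, caret a T₀, by rw [expand_right, ← h1], by
          simp [BinaryTree.numLeaves]; omega, fun x y => ?_⟩
        rw [leaves, List.getElem?_append_right (by simp [length_leaves]), length_leaves,
          Nat.add_sub_cancel_left]
        exact h3 _ _
    · obtain ⟨i, q, T₀, h1, h2, h3⟩ := iha ha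
      refine ⟨i, false :: q, caret T₀ b, by rw [expand_left b h2, ← h1], by
          simp [BinaryTree.numLeaves]; omega, fun x y => ?_⟩
      rw [leaves, List.getElem?_append_left (by simpa [length_leaves])]
      exact h3 _ _

/-- If the `i`-th leaf of `D` is mapped linearly onto a standard interval, then expanding it
in the source requires expanding it in the target. -/
theorem HasTreeDiagram.eq_expand_of_expand {f : I ≃ₜ I} {D R : BinaryTree Unit} {i : ℕ}
    (h : HasTreeDiagram f (expand i D) R) (hi : i < D.numLeaves) {J K : ℝ × ℝ}
    (hJ : (Thompson.leaves D 0 1)[i]? = some J) (hK : IsStandard K) (m : MapsLinearly f J K) :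
    ∃ R₀, R = expand i R₀ ∧ i < R₀.numLeaves := by
  obtain ⟨A, J', B, h1, h2, h3⟩ := leaves_expand hi 0 1
  have e : J' = J := by
    rw [h1, ← h2] at hJ
    simpa using hJ
  subst e
  exact h.eq_expand (by rw [h3, ← h2]; simp) (by rw [h3, ← h2]; simp) hK m.lhalf m.rhalf

end Thompson

namespace Thompson
open Label

/-! ### Each generator raises the minimal cost by at most 1 -/

/-- The set of generators and their inverses. -/
abbrev gens : Set F := {x0, x1, x0⁻¹, x1⁻¹}

theorem HasTreeDiagram.length_labels_eq {f : I ≃ₜ I} {D R : BinaryTree Unit}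
    (h : HasTreeDiagram f D R) : (labels D).length = (labels R).length := by
  have := length_labels D
  have := length_labels R
  have := h.length_eq
  omega

theorem cost_replace {D D' R : BinaryTree Unit} {A B U V : List Label} {x x' y : Label}
    (hD : labels D = A ++ x :: B) (hD' : labels D' = A ++ x' :: B) (hR : labels R = U ++ y :: V)
    (hU : U.length = A.length) :
    cost D' R + weight x y = cost D R + weight x' y := by
  unfold cost
  rw [hD, hD', hR, total_append hU.symm, total_append hU.symm, total_cons, total_cons]
  omega

theorem HasTreeDiagram.split {f : I ≃ₜ I} {D R : BinaryTree Unit} {A B : List Label} {x : Label}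
    (h : HasTreeDiagram f D R) (hD : labels D = A ++ x :: B) :
    ∃ U y V, labels R = U ++ y :: V ∧ U.length = A.length ∧ V.length = B.length :=
  exists_split (by rw [← h.length_labels_eq, hD]; simp)

theorem HasTreeDiagram.ne_nil {f : I ≃ₜ I} {D R : BinaryTree Unit}
    (h : HasTreeDiagram f D R) (hD : D ≠ .nil) : R ≠ .nil := by
  rw [ne_nil_iff] at *
  have := h.length_eq
  omega

theorem HasTreeDiagram.expand {f : I ≃ₜ I} {D R : BinaryTree Unit} {i : ℕ}
    (h : HasTreeDiagram f D R) (hi : i < D.numLeaves) :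
    HasTreeDiagram f (expand i D) (expand i R) :=
  (hasTreeDiagram_expand_iff hi (h.length_eq ▸ hi)).2 h

/-- Ensures that there is a current tree. Expanding the last leaf is free here: opposite `lft`,
applying `toR` does not change the weight, and `fin`, `fin` weighs 0. -/
theorem HasTreeDiagram.exists_right {f : I ≃ₜ I} {D R : BinaryTree Unit}
    (h : HasTreeDiagram f D R) (hD : D ≠ .nil) :
    ∃ l a b R', HasTreeDiagram f (caret l (caret a b)) R' ∧
      cost (caret l (caret a b)) R' = cost D R := by
  have hR := h.ne_nil hD
  match D with
  | .nil => exact absurd rfl hD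
  | .node _ l (.node _ a b) => exact ⟨l, a, b, R, h, rfl⟩
  | .node _ l .nil =>
    have hk := h.expand (i := l.numLeaves) (by simp [BinaryTree.numLeaves])
    have e : Thompson.expand l.numLeaves (.node () l .nil) = caret l (caret .nil .nil) :=
      expand_right 0 l .nil
    rw [e] at hk
    refine ⟨l, .nil, .nil, _, hk, ?_⟩
    obtain ⟨U, y, hy, h1, h2⟩ := labels_expand_last hR
    have h3 := h.length_eq
    simp only [BinaryTree.numLeaves] at h3
    rw [← h3, Nat.add_sub_cancel] at h2
    have h4 := h.length_labels_eq
    rw [h1] at h4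
    simp only [labels, rightLabels, List.length_append] at h4
    unfold cost
    rw [h1, h2, labels, labels, total_append (by simpa using h4), total_append (by simpa using h4)]
    rcases hy with rfl | rfl <;> rfl

theorem exists_x0_mul {f : F} {D R : BinaryTree Unit} (h : HasTreeDiagram (toHomeo f) D R)
    (hD : D ≠ .nil) : ∃ D' R', D' ≠ .nil ∧ HasTreeDiagram (toHomeo (x0 * f)) D' R' ∧
      cost D' R' ≤ cost D R + 1 := by
  obtain ⟨l, a, b, R', h', e⟩ := h.exists_right hD
  refine ⟨_, R', by simp, (hasTreeDiagram_x0 l a b).mul h', ?_⟩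
  have k1 : labels (caret l (caret a b)) =
    (leftLabels l ++ lft :: innerLabels a) ++ spineLabel b :: rightLabels b := by
    simp [labels, rightLabels]
  have k2 : labels (caret (caret l a) b) =
    (leftLabels l ++ lft :: innerLabels a) ++ lft :: rightLabels b := by
    simp [labels, leftLabels]
  obtain ⟨U, y, V, hR, hU, -⟩ := h'.split k1
  have := cost_replace k1 k2 hR hU
  have : weight lft y ≤ weight (spineLabel b) y + 1 := by
    generalize spineLabel b = z
    cases z <;> cases y <;> exact Nat.le_of_ble_eq_true rfl
  omega

theorem exists_x0_inv_mul {f : F} {D R : BinaryTree Unit} (h : HasTreeDiagram (toHomeo f) D R)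
    (hD : D ≠ .nil) : ∃ D' R', D' ≠ .nil ∧ HasTreeDiagram (toHomeo (x0⁻¹ * f)) D' R' ∧
      cost D' R' ≤ cost D R + 1 := by
  have hR := h.ne_nil hD
  match D with
  | .nil => exact absurd rfl hD
  | .node _ (.node _ l a) b =>
    refine ⟨_, R, by simp, (hasTreeDiagram_x0 l a b).inv.mul h, ?_⟩
    have k1 : labels (caret l (caret a b)) =
      (leftLabels l ++ lft :: innerLabels a) ++ spineLabel b :: rightLabels b := by
      simp [labels, rightLabels]
    have k2 : labels (caret (caret l a) b) =
      (leftLabels l ++ lft :: innerLabels a) ++ lft :: rightLabels b := by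
      simp [labels, leftLabels]
    obtain ⟨U, y, V, hR, hU, -⟩ := h.split k2
    have := cost_replace k2 k1 hR hU
    -- The bound fails for `nin` opposite `nin`, so it matters that this label comes from the right
    -- spine.
    have : weight (spineLabel b) y ≤ weight lft y + 1 := by
      match b with
      | .nil => cases y <;> exact Nat.le_of_ble_eq_true rfl
      | .node _ .nil _ => cases y <;> exact Nat.le_of_ble_eq_true rfl
      | .node _ (.node _ _ _) _ => cases y <;> exact Nat.le_of_ble_eq_true rfl
    change cost (caret l (caret a b)) R ≤ cost (caret (caret l a) b) R + 1
    omega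
  | .node _ .nil b =>
    -- With no tree to move to on the left, expanding the first leaf provides a trivial one.
    have hk := h.expand (i := 0) (BinaryTree.numLeaves_pos _)
    rw [show Thompson.expand 0 (.node () .nil b) = caret (caret .nil .nil) b from
      expand_left b (by simp)] at hk
    refine ⟨_, _, by simp, (hasTreeDiagram_x0 .nil .nil b).inv.mul hk, ?_⟩
    obtain ⟨V, hV⟩ := labels_head hR
    unfold cost
    rw [labels_expand_zero hR, hV]
    simp only [labels, leftLabels, rightLabels, innerLabels, List.nil_append, total_cons]
    have : weight (spineLabel b) lft ≤ 1 := by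
      match b with
      | .nil => exact Nat.le_of_ble_eq_true rfl
      | .node _ .nil _ => exact Nat.le_of_ble_eq_true rfl
      | .node _ (.node _ _ _) _ => exact Nat.le_of_ble_eq_true rfl
    omega

theorem exists_x1_mul {f : F} {D R : BinaryTree Unit} (h : HasTreeDiagram (toHomeo f) D R)
    (hD : D ≠ .nil) : ∃ D' R', D' ≠ .nil ∧ HasTreeDiagram (toHomeo (x1 * f)) D' R' ∧
      cost D' R' ≤ cost D R + 1 := by
  obtain ⟨l, a, d, R, h, e⟩ := h.exists_right hD
  rw [← e]
  cases d with
  | node v b c =>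
    refine ⟨_, R, by simp, (hasTreeDiagram_x1 l a b c).mul h, ?_⟩
    have k1 : labels (caret l (caret a (caret b c))) = (leftLabels l ++ lft :: innerLabels a) ++
        spineLabel (caret b c) :: (innerLabels b ++ spineLabel c :: rightLabels c) := by
      simp [labels, rightLabels]
    have k2 : labels (caret l (caret (caret a b) c)) = (leftLabels l ++ lft :: innerLabels a) ++
        innerLabel b :: (innerLabels b ++ spineLabel c :: rightLabels c) := by
      simp [labels, rightLabels, innerLabels]
    obtain ⟨U, y, V, hR, hU, -⟩ := h.split k1
    have := cost_replace k1 k2 hR hU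
    have : weight (innerLabel b) y ≤ weight (spineLabel (caret b c)) y + 1 := by
      match b with
      | .nil => cases y <;> exact Nat.le_of_ble_eq_true rfl
      | .node _ _ _ => cases y <;> exact Nat.le_of_ble_eq_true rfl
    have e : (BinaryTree.node v b c) = caret b c := rfl
    rw [e]
    omega
  | nil =>
    -- The current tree is followed only by the last leaf; expanding that leaf provides a next tree
    -- to join.
    have hk := h.expand (i := l.numLeaves + a.numLeaves) (by simp [BinaryTree.numLeaves])
    have e : Thompson.expand (l.numLeaves + a.numLeaves) (caret l (caret a .nil)) =
        caret l (caret a (caret .nil .nil)) := by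
      rw [expand_right, ← Nat.add_zero a.numLeaves, expand_right]; rfl
    rw [e] at hk
    refine ⟨_, _, by simp, (hasTreeDiagram_x1 l a .nil .nil).mul hk, ?_⟩
    obtain ⟨U, y, hy, h1, h2⟩ := labels_expand_last (h.ne_nil (by simp))
    have h3 := h.length_eq
    simp only [BinaryTree.numLeaves] at h3
    rw [← h3, ← Nat.add_assoc, Nat.add_sub_cancel] at h2
    have h4 := h.length_labels_eq
    have k1 : labels (caret l (caret a .nil)) = (leftLabels l ++ lft :: innerLabels a) ++ [fin] := by
      simp [labels, rightLabels, spineLabel]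
    have k2 : labels (caret l (caret (caret a .nil) .nil)) =
        (leftLabels l ++ lft :: innerLabels a) ++ [inn, fin] := by
      simp [labels, rightLabels, spineLabel, innerLabels, innerLabel]
    rw [h1, k1, List.length_append, List.length_append] at h4
    unfold cost
    rw [h1, h2, k1, k2, total_append (by simpa using h4), total_append (by simpa using h4)]
    rcases hy with rfl | rfl <;> simp [toR, weight]

theorem exists_x1_inv_mul {f : F} {D R : BinaryTree Unit} (h : HasTreeDiagram (toHomeo f) D R)
    (hD : D ≠ .nil) : ∃ D' R', D' ≠ .nil ∧ HasTreeDiagram (toHomeo (x1⁻¹ * f)) D' R' ∧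
      cost D' R' ≤ cost D R + 1 := by
  obtain ⟨l, d, c, R, h, e⟩ := h.exists_right hD
  rw [← e]
  cases d with
  | node v a b =>
    refine ⟨_, R, by simp, (hasTreeDiagram_x1 l a b c).inv.mul h, ?_⟩
    have k1 : labels (caret l (caret a (caret b c))) = (leftLabels l ++ lft :: innerLabels a) ++
        spineLabel (caret b c) :: (innerLabels b ++ spineLabel c :: rightLabels c) := by
      simp [labels, rightLabels]
    have k2 : labels (caret l (caret (caret a b) c)) = (leftLabels l ++ lft :: innerLabels a) ++
        innerLabel b :: (innerLabels b ++ spineLabel c :: rightLabels c) := by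
      simp [labels, rightLabels, innerLabels]
    obtain ⟨U, y, V, hR, hU, -⟩ := h.split k2
    have := cost_replace k2 k1 hR hU
    have : weight (spineLabel (caret b c)) y ≤ weight (innerLabel b) y + 1 := by
      match b with
      | .nil => cases y <;> exact Nat.le_of_ble_eq_true rfl
      | .node _ _ _ => cases y <;> exact Nat.le_of_ble_eq_true rfl
    have e : (BinaryTree.node v a b) = caret a b := rfl
    rw [e]
    omega
  | nil =>
    have hk := h.expand (i := l.numLeaves) (by simp [BinaryTree.numLeaves])
    have e : Thompson.expand l.numLeaves (caret l (caret .nil c)) =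
        caret l (caret (caret .nil .nil) c) := by
      conv_lhs => rw [← Nat.add_zero l.numLeaves]
      rw [expand_right, expand_left c (by simp)]; rfl
    rw [e] at hk
    exact ⟨_, _, by simp, (hasTreeDiagram_x1 l .nil .nil c).inv.mul hk,
      (cost_insert h.length_eq).le⟩

theorem exists_gen_mul {f x : F} (hx : x ∈ gens) {D R : BinaryTree Unit}
    (h : HasTreeDiagram (toHomeo f) D R) (hD : D ≠ .nil) :
    ∃ D' R', D' ≠ .nil ∧ HasTreeDiagram (toHomeo (x * f)) D' R' ∧
      cost D' R' ≤ cost D R + 1 := by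
  rcases hx with rfl | rfl | rfl | rfl
  exacts [exists_x0_mul h hD, exists_x1_mul h hD, exists_x0_inv_mul h hD, exists_x1_inv_mul h hD]

theorem hasTreeDiagram_one : HasTreeDiagram (toHomeo 1) (caret .nil .nil) (caret .nil .nil) := by
  have : MapsLinearly (toHomeo 1) (0, 1) (0, 1) := fun _ _ _ _ hx => hx
  exact (MapsLinearly.leaves (caret .nil .nil) this :)

theorem exists_diagram_of_word {w : List F} (hw : ∀ s ∈ w, s ∈ gens) :
    ∃ D R, D ≠ .nil ∧ HasTreeDiagram (toHomeo w.prod) D R ∧ cost D R ≤ w.length + 2 := by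
  induction w with
  | nil => exact ⟨_, _, by simp, hasTreeDiagram_one, by decide⟩
  | cons x w ih =>
    obtain ⟨D, R, hD, h, hc⟩ := ih fun s hs => hw s (List.mem_cons_of_mem _ hs)
    obtain ⟨D', R', hD', h', hc'⟩ := exists_gen_mul (hw x (by simp)) h hD
    exact ⟨D', R', hD', by simpa using h', by simp; omega⟩

/-! ### Some generator lowers the cost of a reduced diagram -/

/-- Some generator leads to a diagram of lower cost that has no more leaves. -/
def HasDescent (f : F) (D R : BinaryTree Unit) : Prop :=
  ∃ x ∈ gens, ∃ D' R', D' ≠ .nil ∧ HasTreeDiagram (toHomeo (x * f)) D' R' ∧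
    cost D' R' + 1 ≤ cost D R ∧ D'.numLeaves ≤ D.numLeaves

/-- Both trees of a diagram come from expanding the same leaf. -/
def IsReducible (D R : BinaryTree Unit) : Prop :=
  ∃ i D₀ R₀, D₀ ≠ .nil ∧ D = expand i D₀ ∧ R = expand i R₀ ∧ i < D₀.numLeaves

theorem HasDescent.of_left {f : F} {l a b R : BinaryTree Unit} {U V : List Label} {y : Label}
    (h : HasTreeDiagram (toHomeo f) (caret (caret l a) b) R) (hR : labels R = U ++ y :: V)
    (hU : U.length = (leftLabels (caret l a)).length)
    (hy : weight (spineLabel b) y + 1 ≤ weight lft y) :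
    HasDescent f (caret (caret l a) b) R := by
  refine ⟨x0⁻¹, by simp, caret l (caret a b), R, by simp, (hasTreeDiagram_x0 l a b).inv.mul h, ?_,
    by simp [BinaryTree.numLeaves]; omega⟩
  have k1 : labels (caret l (caret a b)) =
    leftLabels (caret l a) ++ spineLabel b :: rightLabels b := by
    simp [labels, rightLabels, leftLabels]
  have := cost_replace (D := caret (caret l a) b) rfl k1 hR hU
  omega

theorem HasDescent.of_right {f : F} {l a b R : BinaryTree Unit} {U V : List Label} {y : Label}
    (h : HasTreeDiagram (toHomeo f) (caret l (caret a b)) R) (hR : labels R = U ++ y :: V)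
    (hU : U.length = (leftLabels (caret l a)).length)
    (hy : weight lft y + 1 ≤ weight (spineLabel b) y) :
    HasDescent f (caret l (caret a b)) R := by
  refine ⟨x0, by simp, caret (caret l a) b, R, by simp, (hasTreeDiagram_x0 l a b).mul h, ?_,
    by simp [BinaryTree.numLeaves]; omega⟩
  have k1 : labels (caret l (caret a b)) =
    leftLabels (caret l a) ++ spineLabel b :: rightLabels b := by
    simp [labels, rightLabels, leftLabels]
  have := cost_replace (D' := caret (caret l a) b) k1 rfl hR hU
  omega

theorem cost_split {l a b c R : BinaryTree Unit} {U V : List Label} {y : Label}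
    (hR : labels R = U ++ y :: V) (hU : U.length = (leftLabels (caret l a)).length) :
    cost (caret l (caret a (caret b c))) R + weight (innerLabel b) y =
      cost (caret l (caret (caret a b) c)) R + weight (spineLabel (caret b c)) y := by
  have k1 : labels (caret l (caret a (caret b c))) = leftLabels (caret l a) ++
      spineLabel (caret b c) :: (innerLabels b ++ spineLabel c :: rightLabels c) := by
    simp [labels, rightLabels, leftLabels]
  have k2 : labels (caret l (caret (caret a b) c)) = leftLabels (caret l a) ++
      innerLabel b :: (innerLabels b ++ spineLabel c :: rightLabels c) := by
    simp [labels, rightLabels, innerLabels, leftLabels]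
  exact cost_replace k2 k1 hR hU

theorem HasDescent.of_split {f : F} {l a b c R : BinaryTree Unit} {U V : List Label} {y : Label}
    (h : HasTreeDiagram (toHomeo f) (caret l (caret (caret a b) c)) R)
    (hR : labels R = U ++ y :: V) (hU : U.length = (leftLabels (caret l a)).length)
    (hy : weight (spineLabel (caret b c)) y + 1 ≤ weight (innerLabel b) y) :
    HasDescent f (caret l (caret (caret a b) c)) R := by
  refine ⟨x1⁻¹, by simp, caret l (caret a (caret b c)), R, by simp,
    (hasTreeDiagram_x1 l a b c).inv.mul h, ?_, by simp [BinaryTree.numLeaves]; omega⟩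
  have := cost_split (c := c) (b := b) hR hU
  omega

/-- Removing a top caret whose right subtree is nontrivial pays off, whatever the target tree is. -/
theorem weight_nex_lt_nin (y : Label) : weight nex y + 1 ≤ weight nin y := by
  cases y <;> exact Nat.le_of_ble_eq_true rfl

theorem reduce_target {f : F} {D₀ R R₀ : BinaryTree Unit} {i : ℕ} (hR : R = expand i R₀)
    (h : HasTreeDiagram (toHomeo f) (expand i D₀) R) (hi : i < D₀.numLeaves) :
    HasTreeDiagram (toHomeo f) D₀ R₀ := by
  subst hR
  refine (hasTreeDiagram_expand_iff hi ?_).1 h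
  have := h.length_eq
  rw [numLeaves_expand, numLeaves_expand] at this
  omega

theorem descent_trivial_root {f : F} {l R : BinaryTree Unit}
    (h : HasTreeDiagram (toHomeo f) (caret l .nil) R) (hl : l ≠ .nil) :
    HasDescent f (caret l .nil) R := by
  cases l with
  | nil => exact absurd rfl hl
  | node v l a =>
    obtain ⟨U, y, hy, h1, -⟩ := labels_expand_last (h.ne_nil (by simp))
    have h2 := h.length_labels_eq
    rw [h1] at h2
    refine HasDescent.of_left (V := []) h h1 ?_ ?_
    · simpa [labels, rightLabels] using h2.symm
    · rcases hy with rfl | rfl <;> decide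

/-- The target labels `p` and `q` of the spaces before and after the current leaf decide. For `p`
equal to `lft` or `inn` the pointer moves left if it can; for most `q` it moves right. The remaining
cases show a caret in the target that a generator can cancel or that contradicts `hred`. -/
theorem descent_trivial_current {f : F} {l c R : BinaryTree Unit}
    (h : HasTreeDiagram (toHomeo f) (caret l (caret .nil c)) R)
    (hred : ¬ IsReducible (caret l (caret .nil c)) R) :
    HasDescent f (caret l (caret .nil c)) R := by
  have hRn := h.ne_nil (by simp)
  have ll := length_leftLabels l
  obtain ⟨U, p, V', hR, hU, hV'⟩ := h.split (A := leftLabels l) (x := lft) rfl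
  obtain ⟨q, V, rfl⟩ : ∃ q V, V' = q :: V := by
    cases V' with
    | nil => simp [rightLabels] at hV'
    | cons q V => exact ⟨q, V, rfl⟩
  have hV : V.length = (rightLabels c).length := by
    simpa [rightLabels, innerLabels] using hV'
  have hq : labels R = (U ++ [p]) ++ q :: V := by simp [hR]
  have adj := adj_of_labels_eq hR
  have hp : l = .nil → U = [] ∧ p = lft := by
    rintro rfl
    obtain ⟨W, hW⟩ := labels_head hRn
    obtain rfl : U = [] := by simpa [leftLabels] using hU
    rw [hR] at hW
    simpa using And.left (List.cons.inj hW)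
  have left : l ≠ .nil → p = lft ∨ p = inn → HasDescent f (caret l (caret .nil c)) R := by
    intro hl hpl
    obtain ⟨l, a, rfl⟩ : ∃ l' a, l = caret l' a := by
      cases l with
      | nil => exact absurd rfl hl
      | node v l a => exact ⟨l, a, rfl⟩
    refine HasDescent.of_left h hR hU ?_
    rcases hpl with rfl | rfl <;> exact Nat.le_of_ble_eq_true rfl
  have right : weight lft q + 1 ≤ weight (spineLabel c) q →
      HasDescent f (caret l (caret .nil c)) R :=
    HasDescent.of_right h hq (by simp [leftLabels, innerLabels, hU])
  have pinn : p = inn → HasDescent f (caret l (caret .nil c)) R := by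
    intro e
    refine left ?_ (.inr e)
    intro hl
    rw [(hp hl).2] at e
    exact absurd e (by simp)
  have qlft : q = lft → HasDescent f (caret l (caret .nil c)) R := by
    rintro rfl
    by_cases hl : l = .nil
    · obtain ⟨rfl, rfl⟩ := hp hl
      subst hl
      -- The pointer is at the far left. Moving it right creates a caret on the first two leaves,
      -- which cancels against the one in the target.
      obtain ⟨R₀, hR₀, e⟩ := labels_lft_lft hR
      have k := (hasTreeDiagram_x0 .nil .nil c).mul h
      rw [← show expand 0 (caret .nil c) = caret (caret .nil .nil) c from
        expand_left c (by simp)] at k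
      refine ⟨x0, by simp, _, R₀, by simp, reduce_target e k (BinaryTree.numLeaves_pos _), ?_, by
        simp [BinaryTree.numLeaves]⟩
      have e' : labels R₀ = lft :: V := by
        have := hR
        rw [e, labels_expand_zero hR₀] at this
        simpa using this
      unfold cost
      rw [hR, e']
      simp only [labels, leftLabels, rightLabels, innerLabels, List.nil_append, total_cons]
      have : 1 ≤ weight (spineLabel c) lft := by
        generalize spineLabel c = z
        cases z <;> decide
      omega
    · exact left hl (adj.1 rfl)
  match c with
  | .nil =>
    obtain rfl : V = [] := by simpa [rightLabels] using hV
    rcases labels_last hq with rfl | rfl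
    · exact qlft rfl
    · rcases labels_fin hR with rfl | ⟨R₀, hR₀, e⟩
      · exact pinn rfl
      · refine absurd ?_ hred
        have e' : R₀.numLeaves - 1 = l.numLeaves := by
          have := h.length_eq
          rw [e, numLeaves_expand] at this
          simp only [BinaryTree.numLeaves] at this
          omega
        refine ⟨l.numLeaves, caret l .nil, R₀, by simp, ?_, e' ▸ e, by
          simp [BinaryTree.numLeaves]⟩
        exact (expand_right 0 l .nil).symm
  | .node _ (.node _ _ _) _ =>
    cases q
    · exact qlft rfl
    all_goals exact right (Nat.le_of_ble_eq_true rfl)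
  | .node _ .nil c =>
    cases q
    · exact qlft rfl
    any_goals first | exact right (Nat.le_of_ble_eq_true rfl)
    by_cases hpi : p = inn
    · exact pinn hpi
    -- Only `q = inn` is left, the one label besides `lft` opposite which `rgt` is cheaper than
    -- `lft`. Then the target has a caret on the current and the next leaf, so joining these by `x1`
    -- makes a common caret.
    · obtain ⟨R₀, e, hi⟩ := labels_eq_expand hq (by
        intro U' hU'
        exact hpi (by simpa using List.append_inj_right' hU' rfl))
      have e' : (U ++ [p]).length = l.numLeaves := by simp; omega
      rw [e'] at e
      have k := (hasTreeDiagram_x1 l .nil .nil c).mul h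
      have e2 : expand l.numLeaves (caret l (caret .nil c)) =
          caret l (caret (caret .nil .nil) c) := by
        conv_lhs => rw [← Nat.add_zero l.numLeaves]
        rw [expand_right, expand_left c (by simp)]; rfl
      rw [← e2] at k
      have k' := reduce_target e k (by simp [BinaryTree.numLeaves])
      refine ⟨x1, by simp, _, R₀, by simp, k', ?_, by simp [BinaryTree.numLeaves]⟩
      rw [e]
      exact (cost_insert k'.length_eq).ge

/-- Removing the top caret of the current tree works unless its right subtree is a leaf and the
opposite label is `rgt`. By `Adj` the next target label is then `nex`, `rgt` or `fin`, and moving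
the pointer right works unless both trees end there. -/
theorem descent_nontrivial_current {f : F} {l a b c R : BinaryTree Unit}
    (h : HasTreeDiagram (toHomeo f) (caret l (caret (caret a b) c)) R) :
    HasDescent f (caret l (caret (caret a b) c)) R := by
  have k2 : labels (caret l (caret (caret a b) c)) = leftLabels (caret l a) ++
      innerLabel b :: (innerLabels b ++ spineLabel c :: rightLabels c) := by
    simp [labels, rightLabels, innerLabels, leftLabels]
  obtain ⟨U, y, V', hR, hU, hV'⟩ := h.split k2
  cases b with
  | node v b b' => exact HasDescent.of_split h hR hU (weight_nex_lt_nin y)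
  | nil =>
    obtain ⟨q, V, rfl⟩ : ∃ q V, V' = q :: V := by
      cases V' with
      | nil => simp [innerLabels] at hV'
      | cons q V => exact ⟨q, V, rfl⟩
    have hV : V.length = (rightLabels c).length := by
      simpa [innerLabels] using hV'
    have hq : labels R = (U ++ [y]) ++ q :: V := by simp [hR]
    have adj := adj_of_labels_eq hR
    have split := HasDescent.of_split h hR hU
    have right : weight lft q + 1 ≤ weight (spineLabel c) q →
        HasDescent f (caret l (caret (caret a .nil) c)) R :=
      HasDescent.of_right h hq (by simp [leftLabels, innerLabels, hU]; omega)
    cases y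
    case fin => exact absurd rfl adj.2.2
    case rgt =>
      have h3 := adj.2.1 rfl
      match c with
      | .node _ (.node _ _ _) _ => rcases h3 with rfl | rfl | rfl <;> exact right (Nat.le_of_ble_eq_true rfl)
      | .node _ .nil _ => rcases h3 with rfl | rfl | rfl <;> exact right (Nat.le_of_ble_eq_true rfl)
      | .nil =>
        rcases h3 with rfl | rfl | rfl
        · exact right (Nat.le_of_ble_eq_true rfl)
        · exact right (Nat.le_of_ble_eq_true rfl)
        · obtain rfl : V = [] := by simpa [rightLabels] using hV
          -- The target ends in `rgt`, `fin`, so its last two leaves form a caret. Applying `x1⁻¹`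
          -- makes the last two leaves of the source a caret too, and the pair cancels.
          rcases labels_fin hR with h4 | ⟨R₀, hR₀, e⟩
          · simp at h4
          · obtain ⟨U', y', hy', k3, k4⟩ := labels_expand_last hR₀
            rw [← e, hR] at k4
            obtain ⟨rfl, k5⟩ := List.append_inj' k4 rfl
            obtain rfl : y' = fin := by
              rcases hy' with rfl | rfl
              · simp [toR] at k5
              · rfl
            have k := (hasTreeDiagram_x1 l a .nil .nil).inv.mul h
            have e2 : expand (l.numLeaves + a.numLeaves) (caret l (caret a .nil)) =
                caret l (caret a (caret .nil .nil)) := by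
              rw [expand_right, ← Nat.add_zero a.numLeaves, expand_right]; rfl
            rw [← e2] at k
            have e' : R₀.numLeaves - 1 = l.numLeaves + a.numLeaves := by
              have := h.length_eq
              rw [e, numLeaves_expand] at this
              simp only [BinaryTree.numLeaves] at this
              omega
            rw [e'] at e
            refine ⟨x1⁻¹, by simp, _, R₀, by simp,
              reduce_target e k (by simp [BinaryTree.numLeaves]), ?_, by
              simp [BinaryTree.numLeaves]⟩
            have k6 : labels (caret l (caret a .nil)) = leftLabels (caret l a) ++ [fin] := by
              simp [labels, rightLabels, spineLabel, leftLabels]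
            unfold cost
            rw [k2, hR, k3, k6, total_append hU.symm, total_append hU.symm]
            exact le_rfl
    all_goals exact split (Nat.le_of_ble_eq_true rfl)

theorem hasDescent {f : F} {D R : BinaryTree Unit} (h : HasTreeDiagram (toHomeo f) D R)
    (hD : D ≠ .nil) (hD' : D ≠ caret .nil .nil) (hred : ¬ IsReducible D R) :
    HasDescent f D R := by
  match D with
  | .nil => exact absurd rfl hD
  | .node _ l .nil => exact descent_trivial_root h (by rintro rfl; exact hD' rfl)
  | .node _ l (.node _ .nil c) => exact descent_trivial_current h hred
  | .node _ l (.node _ (.node _ a b) c) => exact descent_nontrivial_current h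

/-! ### From descents to words -/

theorem eq_one_of_maps {f : F} (h : MapsLinearly (toHomeo f) (0, 1) (0, 1)) : f = 1 := by
  refine Subtype.ext (MulOpposite.unop_injective (Homeomorph.ext fun t => Subtype.ext ?_))
  have := h t t.2.1 t.2.2 t (by simp)
  change (toHomeo f t : ℝ) = t
  rw [this]; simp

theorem mem_gens_inv {x : F} (h : x ∈ gens) : x⁻¹ ∈ gens := by
  rcases h with rfl | rfl | rfl | rfl <;> simp

theorem exists_word {f : F} {D R : BinaryTree Unit} (h : HasTreeDiagram (toHomeo f) D R)
    (hD : D ≠ .nil) : ∃ w, IsWordFor f w ∧ w.length + 2 ≤ cost D R := by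
  -- A reduction may leave the cost unchanged but removes a leaf; a descent lowers the cost without
  -- adding leaves. The sum drops in both cases.
  obtain ⟨n, hn⟩ : ∃ n, cost D R + D.numLeaves = n := ⟨_, rfl⟩
  induction n using Nat.strong_induction_on generalizing f D R with
  | _ n ih =>
    by_cases hred : IsReducible D R
    · obtain ⟨i, D₀, R₀, hD₀, rfl, rfl, hi⟩ := hred
      have k := reduce_target rfl h hi
      have := cost_le_cost_expand hD₀ k.length_eq hi
      have e := numLeaves_expand i D₀
      obtain ⟨w, hw, hl⟩ := ih _ (by omega) k hD₀ rfl
      exact ⟨w, hw, by omega⟩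
    · by_cases hD' : D = caret .nil .nil
      · subst hD'
        have e : R = caret .nil .nil := by
          have := h.length_eq
          match R, this with
          | .nil, this => simp [BinaryTree.numLeaves] at this
          | .node _ a b, this =>
            have ha := a.numLeaves_pos
            have hb := b.numLeaves_pos
            have : a = .nil := by
              by_contra h
              have := ne_nil_iff.1 h
              simp [BinaryTree.numLeaves] at *; omega
            have : b = .nil := by
              by_contra h
              have := ne_nil_iff.1 h
              simp [BinaryTree.numLeaves] at *; omega
            subst a b
            rfl
        subst e
        have k := reduce_target (D₀ := .nil) (R₀ := .nil) (i := 0) rfl h (by simp)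
        have := eq_one_of_maps (List.forall₂_cons.1 k).1
        subst this
        exact ⟨[], ⟨by simp, rfl⟩, by decide⟩
      · obtain ⟨x, hx, D', R', hD', h', hc, hl⟩ := hasDescent h hD hD' hred
        obtain ⟨w, ⟨hw1, hw2⟩, hl'⟩ := ih _ (by omega) h' hD' rfl
        refine ⟨x⁻¹ :: w, ⟨?_, by simp [hw2]⟩, by simp; omega⟩
        intro s hs
        rcases List.mem_cons.1 hs with rfl | hs
        · exact mem_gens_inv hx
        · exact hw1 s hs

end Thompson

namespace Thompson
open Label

/-! ### Lengths and costs -/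

theorem exists_hasTreeDiagram_ne_nil (f : F) :
    ∃ D R, D ≠ .nil ∧ HasTreeDiagram (toHomeo f) D R := by
  obtain ⟨D, R, h⟩ := exists_hasTreeDiagram f
  exact ⟨_, _, expand_ne_nil 0 D, h.expand D.numLeaves_pos⟩

theorem length_le {f : F} {w : List F} (h : IsWordFor f w) : length f ≤ w.length :=
  Nat.sInf_le ⟨w, h, rfl⟩

theorem exists_geodesic (f : F) : ∃ w, IsWordFor f w ∧ w.length = length f := by
  obtain ⟨D, R, hD, h⟩ := exists_hasTreeDiagram_ne_nil f
  obtain ⟨w, hw, -⟩ := exists_word h hD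
  exact Nat.sInf_mem (s := {n : ℕ | ∃ w : List F, IsWordFor f w ∧ w.length = n}) ⟨_, w, hw, rfl⟩

theorem length_add_two_le_cost {f : F} {D R : BinaryTree Unit}
    (h : HasTreeDiagram (toHomeo f) D R) (hD : D ≠ .nil) : length f + 2 ≤ cost D R := by
  obtain ⟨w, hw, hl⟩ := exists_word h hD
  have := length_le hw
  omega

/-- Every element has a reduced diagram of minimal cost, and this cost gives its length. -/
theorem exists_minimal_diagram (f : F) : ∃ D R, D ≠ .nil ∧ HasTreeDiagram (toHomeo f) D R ∧
    cost D R = length f + 2 ∧ ¬ IsReducible D R := by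
  classical
  have hex : ∃ n D R, D ≠ .nil ∧ HasTreeDiagram (toHomeo f) D R ∧
      cost D R = length f + 2 ∧ D.numLeaves = n := by
    obtain ⟨w, ⟨hw, rfl⟩, hl⟩ := exists_geodesic f
    obtain ⟨D, R, hD, h, hc⟩ := exists_diagram_of_word hw
    have := length_add_two_le_cost h hD
    exact ⟨_, D, R, hD, h, by omega, rfl⟩
  obtain ⟨D, R, hD, h, hc, hn⟩ := Nat.find_spec hex
  refine ⟨D, R, hD, h, hc, ?_⟩
  rintro ⟨i, D₀, R₀, hD₀, rfl, rfl, hi⟩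
  have k := reduce_target rfl h hi
  have h1 := cost_le_cost_expand hD₀ k.length_eq hi
  have h2 := length_add_two_le_cost k hD₀
  rw [numLeaves_expand] at hn
  exact Nat.find_min hex (m := D₀.numLeaves) (by omega) ⟨D₀, R₀, hD₀, k, by omega, rfl⟩

theorem isWordFor_cons {f x : F} (hx : x ∈ gens) {w : List F} (hw : IsWordFor f w) :
    IsWordFor (x * f) (x :: w) := by
  refine ⟨fun s hs => ?_, by simp [hw.2]⟩
  rcases List.mem_cons.1 hs with rfl | hs
  exacts [hx, hw.1 s hs]

theorem length_gen_mul_le {f x : F} (hx : x ∈ gens) : length (x * f) ≤ length f + 1 := by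
  obtain ⟨w, hw, hl⟩ := exists_geodesic f
  simpa [hl] using length_le (isWordFor_cons hx hw)

theorem length_le_gen_mul {f x : F} (hx : x ∈ gens) : length f ≤ length (x * f) + 1 := by
  simpa using length_gen_mul_le (f := x * f) (mem_gens_inv hx)

/-! ### The parity of the length -/

/-- `f` has slope `2 ^ k` at 1. -/
def HasSlope (f : F) (k : ℤ) : Prop :=
  ∃ ε : ℝ, 0 < ε ∧ ∀ t : I, 1 - ε ≤ t → 1 - (toHomeo f t : ℝ) = 2 ^ k * (1 - t)

theorem HasSlope.mul {f g : F} {k m : ℤ} (hf : HasSlope f k) (hg : HasSlope g m) :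
    HasSlope (f * g) (k + m) := by
  obtain ⟨ε, h0, h1⟩ := hf
  obtain ⟨δ, k0, k1⟩ := hg
  have h2 : (0 : ℝ) < 2 ^ k := by positivity
  -- Since `f` scales distances to 1 by `2 ^ k`, the second bound keeps the image of `t` within `δ`
  -- of 1.
  refine ⟨min ε (δ / 2 ^ k), lt_min h0 (by positivity), fun t ht => ?_⟩
  have a1 := h1 t (by linarith [min_le_left ε (δ / 2 ^ k)])
  have a2 : 2 ^ k * (1 - (t : ℝ)) ≤ δ := by
    rw [mul_comm, ← le_div_iff₀ h2]
    linarith [min_le_right ε (δ / 2 ^ k)]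
  rw [mul_apply, k1 _ (by linarith), a1, zpow_add₀ two_ne_zero]
  ring

theorem HasSlope.unique {f : F} {k m : ℤ} (hk : HasSlope f k) (hm : HasSlope f m) : k = m := by
  obtain ⟨ε, h0, h1⟩ := hk
  obtain ⟨δ, k0, k1⟩ := hm
  obtain ⟨η, e0, e1⟩ : ∃ η : ℝ, 0 < η ∧ η ≤ ε ∧ η ≤ δ ∧ η ≤ 1 :=
    ⟨min ε (min δ 1), by positivity, min_le_left _ _, (min_le_right _ _).trans (min_le_left _ _),
      (min_le_right _ _).trans (min_le_right _ _)⟩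
  have a := h1 ⟨1 - η, by linarith, by linarith⟩ (by simp only; linarith)
  have b := k1 ⟨1 - η, by linarith, by linarith⟩ (by simp only; linarith)
  rw [a] at b
  have : (2 : ℝ) ^ k = 2 ^ m := mul_right_cancel₀ (by simp only [sub_sub_cancel]; exact e0.ne') b
  exact zpow_right_injective₀ two_pos (by norm_num) this

theorem exists_hasSlope_gen {x : F} (hx : x ∈ gens) : ∃ k, HasSlope x k ∧ Odd k := by
  rcases hx with rfl | rfl | rfl | rfl
  · refine ⟨-1, ⟨1 / 2, by norm_num, fun t ht => ?_⟩, by decide⟩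
    have h0 := t.2.2
    have e : (toHomeo x0 t : ℝ) = min (2 * (t : ℝ)) (min (t + 1 / 4) ((t + 1) / 2)) := rfl
    rw [e, min_eq_right, min_eq_right]
    · norm_num; ring
    · linarith
    · rw [min_eq_right] <;> linarith
  · refine ⟨-1, ⟨1 / 4, by norm_num, fun t ht => ?_⟩, by decide⟩
    have h0 := t.2.2
    have e : (toHomeo x1 t : ℝ) =
      max (t : ℝ) (min (2 * t - 1 / 2) (min (t + 1 / 8) ((t + 1) / 2))) := rfl
    have e1 : min ((t : ℝ) + 1 / 8) ((t + 1) / 2) = (t + 1) / 2 := min_eq_right (by linarith)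
    have e2 : min (2 * (t : ℝ) - 1 / 2) ((t + 1) / 2) = (t + 1) / 2 := min_eq_right (by linarith)
    rw [e, e1, e2, max_eq_right (by linarith)]
    norm_num; ring
  · refine ⟨1, ⟨1 / 4, by norm_num, fun t ht => ?_⟩, by decide⟩
    have h0 := t.2.2
    have e : (toHomeo x0⁻¹ t : ℝ) = max ((t : ℝ) / 2) (max (t - 1 / 4) (2 * t - 1)) := rfl
    have e1 : max ((t : ℝ) - 1 / 4) (2 * t - 1) = 2 * t - 1 := max_eq_right (by linarith)
    rw [e, e1, max_eq_right (by linarith)]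
    norm_num; ring
  · refine ⟨1, ⟨1 / 8, by norm_num, fun t ht => ?_⟩, by decide⟩
    have h0 := t.2.2
    have e : (toHomeo x1⁻¹ t : ℝ) =
      min (t : ℝ) (max (t / 2 + 1 / 4) (max (t - 1 / 8) (2 * t - 1))) := rfl
    have e1 : max ((t : ℝ) - 1 / 8) (2 * t - 1) = 2 * t - 1 := max_eq_right (by linarith)
    have e2 : max ((t : ℝ) / 2 + 1 / 4) (2 * t - 1) = 2 * t - 1 := max_eq_right (by linarith)
    rw [e, e1, e2, min_eq_right (by linarith)]
    norm_num; ring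

theorem exists_hasSlope_prod {w : List F} (hw : ∀ s ∈ w, s ∈ gens) :
    ∃ k, HasSlope w.prod k ∧ Even (k - w.length) := by
  induction w with
  | nil => exact ⟨0, ⟨1, one_pos, fun t _ => by simp; rfl⟩, by simp⟩
  | cons x w ih =>
    obtain ⟨k, hk, ek⟩ := ih fun s hs => hw s (List.mem_cons_of_mem _ hs)
    obtain ⟨m, hm, em⟩ := exists_hasSlope_gen (hw x (by simp))
    refine ⟨m + k, by simpa using hm.mul hk, ?_⟩
    obtain ⟨i, hi⟩ := ek
    obtain ⟨j, hj⟩ := em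
    exact ⟨i + j, by simp only [List.length_cons]; push_cast; linarith⟩

/-- The exponent of the slope at 1 is additive and odd on generators, so all words for one element
have lengths of the same parity. -/
theorem length_gen_mul_ne {f x : F} (hx : x ∈ gens) : length (x * f) ≠ length f := by
  obtain ⟨w, hw, hl⟩ := exists_geodesic f
  obtain ⟨w', hw', hl'⟩ := exists_geodesic (x * f)
  have h := isWordFor_cons hx hw
  obtain ⟨k, hk, i, hi⟩ := exists_hasSlope_prod h.1
  obtain ⟨m, hm, j, hj⟩ := exists_hasSlope_prod hw'.1
  rw [h.2] at hk
  rw [hw'.2] at hm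
  have := hk.unique hm
  rw [List.length_cons, hl] at hi
  push_cast at hi
  intro e
  rw [hl', e] at hj
  omega

/-! ### Trivial trees at and after the pointer -/

/-- The interval at the pointer, `[1/2, 3/4]`. -/
noncomputable abbrev current : ℝ × ℝ := sub [true, false] (0, 1)

/-- The interval after the pointer, `[3/4, 7/8]`. -/
noncomputable abbrev next : ℝ × ℝ := sub [true, true, false] (0, 1)

theorem maps_x0_current : MapsLinearly (toHomeo x0) current next := by
  have h := hasTreeDiagram_x0 .nil .nil .nil
  simp only [HasTreeDiagram, leaves, List.cons_append, List.nil_append, List.forall₂_cons] at h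
  exact h.2.2.1.lhalf

theorem maps_x1_inv : MapsLinearly (toHomeo x1⁻¹) current (lhalf current) ∧
    MapsLinearly (toHomeo x1⁻¹) next (rhalf current) := by
  have h := (hasTreeDiagram_x1 .nil .nil .nil .nil).inv
  simp only [HasTreeDiagram, leaves, List.cons_append, List.nil_append, List.forall₂_cons] at h
  exact ⟨h.2.1, h.2.2.1⟩

theorem MapsLinearly.unique_sub {f : I ≃ₜ I} {p : List Bool} {K M : ℝ × ℝ}
    (hK : MapsLinearly f (Thompson.sub p (0, 1)) K)
    (hM : MapsLinearly f (Thompson.sub p (0, 1)) M) : K = M := by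
  have := sub_bounds p (J := ((0 : ℝ), (1 : ℝ))) (by simp)
  exact hK.unique this.1 this.2.1 this.2.2 hM

/-- `x1⁻¹` maps `next` onto the right half of `current`. So every diagram of `x1 * f` has to
subdivide that half, the top caret of its current tree has a nontrivial right subtree, and removing
this caret lowers the cost. -/
theorem length_lt_x1_mul {f : F}
    (h : ¬ ∃ K, IsStandard K ∧ MapsLinearly (toHomeo f) next K) :
    length f < length (x1 * f) := by
  have key : ¬ ∃ K, IsStandard K ∧ MapsLinearly (toHomeo (x1 * f)) (rhalf current) K := by
    rintro ⟨K, hK, m⟩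
    refine h ⟨K, hK, ?_⟩
    simpa using maps_x1_inv.2.mul m
  obtain ⟨D, R, hD, hd, hc, -⟩ := exists_minimal_diagram (x1 * f)
  match D with
  | .nil => exact absurd rfl hD
  | .node _ l .nil =>
    obtain ⟨K, hK, m⟩ := hd.exists_maps (J := sub [true] (0, 1)) (by simp [leaves, sub, rhalf])
    exact absurd ⟨_, hK.sub [false, true], m.sub [false, true]⟩ key
  | .node _ l (.node _ .nil c) =>
    obtain ⟨K, hK, m⟩ := hd.exists_maps (J := current)
      (by simp [leaves, sub, lhalf, rhalf])
    exact absurd ⟨_, hK.rhalf, m.rhalf⟩ key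
  | .node _ l (.node _ (.node _ a .nil) c) =>
    obtain ⟨K, hK, m⟩ := hd.exists_maps (J := rhalf current)
      (by simp [leaves, sub, lhalf, rhalf])
    exact absurd ⟨K, hK, m⟩ key
  | .node _ l (.node _ (.node _ a (.node _ b b')) c) =>
    have k := (hasTreeDiagram_x1 l a (caret b b') c).inv.mul hd
    rw [inv_mul_cancel_left] at k
    have h1 := length_add_two_le_cost k (by simp)
    have k2 : labels (caret l (caret (caret a (caret b b')) c)) = leftLabels (caret l a) ++
        nin :: (innerLabels (caret b b') ++ spineLabel c :: rightLabels c) := by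
      simp [labels, rightLabels, innerLabels, leftLabels, innerLabel]
    obtain ⟨U, y, V, hR, hU, -⟩ := hd.split k2
    have h2 := cost_split (b := caret b b') (c := c) hR hU
    have h3 : weight (spineLabel (caret (caret b b') c)) y + 1 ≤
      weight (innerLabel (caret b b')) y := weight_nex_lt_nin y
    change cost (caret l (caret (caret a (caret b b')) c)) R = _ at hc
    omega

/-- The product maps `current` and `next` linearly onto the halves of `K`. In a reduced diagram both
are then leaves of the source, and the target has a caret over their images. Multiplying by `x1`
produces the matching caret; cancelling it saves exactly 1 by `cost_insert`. -/
theorem length_lt_x1_inv_mul {f : F} {K : ℝ × ℝ} (hK : IsStandard K)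
    (h : MapsLinearly (toHomeo f) current K) : length f < length (x1⁻¹ * f) := by
  have m0 := maps_x1_inv.1.mul h.lhalf
  have m1 := maps_x1_inv.2.mul h.rhalf
  obtain ⟨D, R, hD, hd, hc, hred⟩ := exists_minimal_diagram (x1⁻¹ * f)
  match D with
  | .nil => exact absurd rfl hD
  | .node _ l .nil =>
    obtain ⟨M, hM, m⟩ := hd.exists_maps (J := sub [true] (0, 1)) (by simp [leaves, sub, rhalf])
    -- Were the map linear on `[1/2, 1]`, the image of `current` would be twice as long as that of
    -- `next`, but both are halves of `K`.
    have e0 := m0.unique_sub (m.sub [false])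
    have e1 := m1.unique_sub (m.sub [true, false])
    have := hM.lt
    simp only [sub, lhalf, rhalf, Prod.mk.injEq] at e0 e1
    linarith [e0.1, e0.2, e1.1, e1.2]
  | .node _ l (.node _ (.node _ a a') c) =>
    -- The map is linear on `current`, so any caret of the source inside it has a counterpart in the
    -- target.
    refine absurd ?_ hred
    obtain ⟨i, q, T, h1, h2, h3⟩ := exists_expand (T := caret a a') (by simp)
    have e : caret l (caret (caret a a') c) =
        expand (l.numLeaves + i) (caret l (caret T c)) := by
      rw [expand_right, expand_left c h2, h1]
    have hi : l.numLeaves + i < (caret l (caret T c)).numLeaves := by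
      simp [BinaryTree.numLeaves]; omega
    change HasTreeDiagram _ (caret l (caret (caret a a') c)) R at hd
    rw [e] at hd
    obtain ⟨R₀, hR, -⟩ := hd.eq_expand_of_expand hi (J := sub q current) (by
      rw [leaves, List.getElem?_append_right (by simp [length_leaves]), length_leaves,
        Nat.add_sub_cancel_left, leaves, List.getElem?_append_left (by simpa [length_leaves])]
      exact h3 _ _) (hK.lhalf.sub q) (m0.sub q)
    exact ⟨_, _, _, by simp, e, hR, hi⟩
  | .node _ l (.node _ .nil .nil) =>
    obtain ⟨M, hM, m⟩ := hd.exists_maps (J := sub [true, true] (0, 1))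
      (by simp [leaves, sub, rhalf])
    -- `next` is the left half of the leaf `[3/4, 1]`, but its image is a right half.
    exact absurd (m1.unique_sub (m.sub [false])).symm (hM.lhalf_ne_rhalf hK)
  | .node _ l (.node _ .nil (.node _ (.node _ a a') c)) =>
    refine absurd ?_ hred
    obtain ⟨i, q, T, h1, h2, h3⟩ := exists_expand (T := caret a a') (by simp)
    have e : caret l (caret .nil (caret (caret a a') c)) =
        expand (l.numLeaves + (1 + i)) (caret l (caret .nil (caret T c))) := by
      rw [expand_right]
      have := expand_right i .nil (caret T c)
      rw [BinaryTree.numLeaves] at this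
      rw [this, expand_left c h2, h1]
    have hi : l.numLeaves + (1 + i) < (caret l (caret .nil (caret T c))).numLeaves := by
      simp [BinaryTree.numLeaves]; omega
    change HasTreeDiagram _ (caret l (caret .nil (caret (caret a a') c))) R at hd
    rw [e] at hd
    obtain ⟨R₀, hR, -⟩ := hd.eq_expand_of_expand hi (J := sub q next) (by
      rw [leaves, List.getElem?_append_right (by simp [length_leaves]), length_leaves,
        Nat.add_sub_cancel_left, leaves, List.getElem?_append_right (by simp [leaves]),
        leaves, List.length_singleton, Nat.add_sub_cancel_left, leaves,
        List.getElem?_append_left (by simpa [length_leaves])]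
      exact h3 _ _) (hK.rhalf.sub q) (m1.sub q)
    exact ⟨_, _, _, by simp, e, hR, hi⟩
  | .node _ l (.node _ .nil (.node _ .nil c)) =>
    obtain ⟨R₀, hR, -⟩ := hd.eq_expand (i := l.numLeaves) (J := current) (J' := next) (by
      rw [leaves, List.getElem?_append_right (by simp [length_leaves]), length_leaves,
        Nat.sub_self]
      rfl) (by
      rw [leaves, List.getElem?_append_right (by simp [length_leaves]), length_leaves,
        Nat.add_sub_cancel_left]
      rfl) hK m0 m1
    have k := (hasTreeDiagram_x1 l .nil .nil c).mul hd
    rw [mul_inv_cancel_left] at k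
    have e2 : expand l.numLeaves (caret l (caret .nil c)) =
        caret l (caret (caret .nil .nil) c) := by
      conv_lhs => rw [← Nat.add_zero l.numLeaves]
      rw [expand_right, expand_left c (by simp)]; rfl
    rw [← e2] at k
    have k' := reduce_target hR k (by simp [BinaryTree.numLeaves])
    have h1 := length_add_two_le_cost k' (by simp)
    have h2 := cost_insert k'.length_eq
    rw [← hR] at h2
    change cost (caret l (caret .nil (caret .nil c))) R = _ at hc
    omega

theorem length_x1_inv_mul {f : F} {K : ℝ × ℝ} (hK : IsStandard K)
    (h : MapsLinearly (toHomeo f) current K) : length (x1⁻¹ * f) = length f + 1 := by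
  have := length_lt_x1_inv_mul hK h
  have := length_gen_mul_le (f := f) (x := x1⁻¹) (by simp)
  omega

/-! ### Dead ends and pockets -/

theorem IsDeadEnd.length_eq {f : F} (hf : IsDeadEnd f) :
    length (x1⁻¹ * x1⁻¹ * x0 * f) = length f + 1 := by
  obtain ⟨K, hK, m⟩ : ∃ K, IsStandard K ∧ MapsLinearly (toHomeo f) next K := by
    by_contra h
    exact absurd (length_lt_x1_mul h) (hf x1 (by simp)).not_gt
  have h1 := hf x0 (by simp)
  have h2 := length_le_gen_mul (f := f) (x := x0) (by simp)
  have m0 := maps_x0_current.mul m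
  have h3 := length_x1_inv_mul hK m0
  have h4 := length_x1_inv_mul hK.lhalf (maps_x1_inv.1.mul m0.lhalf)
  rw [mul_assoc, mul_assoc]
  omega

/-- Factors 1 are allowed in the definition, so shorter words are padded with them. -/
theorem IsPocket.length_prod_mul_le {k : ℕ} {f : F} (hf : IsPocket k f) {L : List F}
    (hL : ∀ s ∈ L, s ∈ gens) (hk : L.length ≤ k) : length (L.prod * f) ≤ length f := by
  have key : ∀ (L : List F) (k : ℕ), L.length ≤ k →
      (List.ofFn fun i : Fin k => L.getD i 1).prod = L.prod := by
    intro L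
    induction L with
    | nil => intro k _; simp
    | cons x L ih =>
      intro k hk
      obtain ⟨k, rfl⟩ : ∃ j, k = j + 1 := ⟨k - 1, by simp at hk; omega⟩
      rw [List.ofFn_succ, List.prod_cons, List.prod_cons, ← ih k (by simpa using hk)]
      simp
  have := hf (fun i => L.getD i 1) (fun i => by
    by_cases hi : (i : ℕ) < L.length
    · have := hL _ (List.getElem_mem hi)
      simp only [List.getD_eq_getElem _ _ hi]
      rcases this with h | h | h | h <;> simp_all
    · simp only [List.getD_eq_default _ _ (not_lt.1 hi)]
      simp)
  rwa [key L k hk] at this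

/-- Parity makes the inequality strict. -/
theorem IsPocket.isDeadEnd {k : ℕ} {f : F} (hf : IsPocket k f) (hk : 1 ≤ k) : IsDeadEnd f := by
  intro x hx
  have := hf.length_prod_mul_le (L := [x]) (by simpa using hx) (by simpa)
  simp only [List.prod_singleton] at this
  exact lt_of_le_of_ne this (length_gen_mul_ne hx)

end Thompson

theorem proposition5p1p5 :
    (∀ k : ℕ, 3 ≤ k → ∀ f : Thompson.F, ¬ Thompson.IsPocket k f) ∧
      ∀ f : Thompson.F, Thompson.IsDeadEnd f →
        Thompson.length (Thompson.x1⁻¹ * Thompson.x1⁻¹ * Thompson.x0 * f) =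
          Thompson.length f + 1 := by
  refine ⟨fun k hk f hf => ?_, fun f hf => hf.length_eq⟩
  have h1 := (hf.isDeadEnd (by omega)).length_eq
  have h2 := hf.length_prod_mul_le (L := [Thompson.x1⁻¹, Thompson.x1⁻¹, Thompson.x0])
    (by simp) (by simpa)
  simp only [List.prod_cons, List.prod_nil, mul_one, ← mul_assoc] at h2
  omega
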